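/- Let $q$ be a prime power and let $n,l,m$ be integers with $1<m<n-1$ and $l>0$. Let $E$ be the subspace of $\mathbb F_q^{\,n+l}$ spanned by the last $l$ standard basis vectors $e_{n+1},\dots,e_{n+l}$. Let $X_m$ be the set of all $m$-dimensional subspaces $P$ of $\mathbb F_q^{\,n+l}$ with $P\cap E=0$ (the subspaces of type $(m,0)$), and for $P\in X_m$ let $P'\subseteq\mathbb F_q^{\,n}$ be the image of $P$ under the projection onto the first $n$ coordinates. For $0\le i\le\min\{m,n-m\}$ and $0\le j-i\le\min\{m-i,j,l\}$ put $$R_{i,j-i}=\{(P,Q)\in X_m\times X_m : \dim(P'\cap Q')=m-i,\ \dim(P\cap Q)=m-j\}.$$ These relations form a symmetric association scheme $\mathfrak X_m$ on $X_m$. Let $\mathrm{Aut}(\mathfrak X_m)$ be its full automorphism group, that is, the group of all permutations $\sigma$ of $X_m$ for which there is a permutation $\bar\sigma$ of the set of indices of the relations such that $\sigma$ carries each relation $R_{\alpha}$ onto $R_{\bar\sigma(\alpha)}$. Let $P\Gamma L(n+l,\mathbb F_q)$ be the group of all bijective semilinear maps of $\mathbb F_q^{\,n+l}$ modulo the nonzero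 scalar maps, and let $P\Gamma L(n+l,\mathbb F_q)_E$ be the stabilizer of $E$ in it, which acts on $X_m$ by taking images of subspaces. Then $$\mathrm{Aut}(\mathfrak X_m)=P\Gamma L(n+l,\mathbb F_q)_E$$ as permutation groups on $X_m$: the action of $P\Gamma L(n+l,\mathbb F_q)_E$ on $X_m$ is faithful, and the permutations of $X_m$ that it induces are exactly the automorphisms of $\mathfrak X_m$. -/

import Mathlib

namespace AttenuatedSpace

section SemilinearGroup

variable (F : Type*) [Field F] (V : Type*) [AddCommGroup V] [Module F V]

/-- The general semilinear group of `V`: all additive bijections `g` of `V` such that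
`g (c • v) = σ c • g v` for some field automorphism `σ` of `F`. The product is composition. -/
def GammaL : Subgroup (Equiv.Perm V) where
  carrier := {g | (∀ u v : V, g (u + v) = g u + g v) ∧
    ∃ σ : F ≃+* F, ∀ (c : F) (v : V), g (c • v) = σ c • g v}
  one_mem' := ⟨fun _ _ => rfl, RingEquiv.refl F, fun _ _ => rfl⟩
  mul_mem' := by
    rintro g h ⟨hg, σ, hσ⟩ ⟨hh, τ, hτ⟩
    exact ⟨fun u v => by simp [hg, hh], τ.trans σ, fun c v => by simp [hτ, hσ]⟩
  inv_mem' := by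
    rintro g ⟨hg, σ, hσ⟩
    refine ⟨fun u v => ?_, σ.symm, fun c v => ?_⟩
    · apply g.injective
      rw [hg]
      simp
    · apply g.injective
      rw [hσ]
      simp

/-- The subgroup of nonzero scalar maps `v ↦ c • v`. -/
def scalars : Subgroup (GammaL F V) where
  carrier := {g | ∃ c : Fˣ, ∀ v : V, (g : Equiv.Perm V) v = (c : F) • v}
  one_mem' := ⟨1, fun v => by simp⟩
  mul_mem' := by
    rintro g h ⟨c, hc⟩ ⟨d, hd⟩
    exact ⟨c * d, fun v => by simp [hc, hd, mul_smul]⟩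
  inv_mem' := by
    rintro g ⟨c, hc⟩
    refine ⟨c⁻¹, fun v => ?_⟩
    apply (g : Equiv.Perm V).injective
    rw [hc (_ • v)]
    simp

instance scalars_normal : (scalars F V).Normal where
  conj_mem := by
    rintro h ⟨c, hc⟩ g
    obtain ⟨_, σ, hσ⟩ := g.2
    refine ⟨Units.map σ.toMonoidHom c, fun v => ?_⟩
    simp [hc, hσ]

/-- The projective semilinear group of `V`: the semilinear group modulo the scalar maps. -/
def PGammaL : Type _ := GammaL F V ⧸ scalars F V

instance instGroupPGammaL : Group (PGammaL F V) := inferInstanceAs (Group (GammaL F V ⧸ scalars F V))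

variable {F V}

/-- The image of a subspace under a semilinear bijection. -/
def mapSubspace (g : GammaL F V) (P : Submodule F V) : Submodule F V where
  carrier := (g : Equiv.Perm V) '' (P : Set V)
  zero_mem' := ⟨0, P.zero_mem, by simpa using g.2.1 0 0⟩
  add_mem' := by
    rintro _ _ ⟨x, hx, rfl⟩ ⟨y, hy, rfl⟩
    exact ⟨x + y, P.add_mem hx hy, g.2.1 x y⟩
  smul_mem' := by
    rintro c _ ⟨x, hx, rfl⟩
    obtain ⟨_, σ, hσ⟩ := g.2
    exact ⟨σ.symm c • x, P.smul_mem _ hx, by simp [hσ]⟩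

theorem coe_mapSubspace (g : GammaL F V) (P : Submodule F V) :
    (mapSubspace g P : Set V) = (g : Equiv.Perm V) '' (P : Set V) := rfl

/-- The semilinear group acts on subspaces by taking images. -/
instance instMulActionGammaL : MulAction (GammaL F V) (Submodule F V) where
  smul := mapSubspace
  one_smul P := SetLike.coe_injective (by
    change ((1 : GammaL F V) : Equiv.Perm V) '' (P : Set V) = P
    simp)
  mul_smul g h P := SetLike.coe_injective (by
    change ((g * h : GammaL F V) : Equiv.Perm V) '' (P : Set V)
      = (g : Equiv.Perm V) '' ((h : Equiv.Perm V) '' (P : Set V))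
    rw [Set.image_image]
    rfl)

theorem coe_smul (g : GammaL F V) (P : Submodule F V) :
    ((g • P : Submodule F V) : Set V) = (g : Equiv.Perm V) '' (P : Set V) := rfl

theorem scalars_smul (g : GammaL F V) (hg : g ∈ scalars F V) (P : Submodule F V) :
    g • P = P := by
  obtain ⟨c, hc⟩ := hg
  ext v
  rw [← SetLike.mem_coe, coe_smul]
  constructor
  · rintro ⟨x, hx, rfl⟩
    rw [hc]
    exact P.smul_mem _ hx
  · intro hv
    exact ⟨(c⁻¹ : F) • v, P.smul_mem _ hv, by simp [hc]⟩

/-- The action of the projective semilinear group on subspaces, induced by that of the semilinear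
group (scalar maps act trivially). -/
def subspacePerm : PGammaL F V →* Equiv.Perm (Submodule F V) :=
  QuotientGroup.lift (scalars F V) (MulAction.toPermHom (GammaL F V) (Submodule F V))
    (fun g hg => Equiv.ext fun P => scalars_smul g hg P)

instance instMulActionPGammaL : MulAction (PGammaL F V) (Submodule F V) :=
  MulAction.compHom _ (subspacePerm (F := F) (V := V))

theorem exists_rep (g : PGammaL F V) :
    ∃ h : GammaL F V, ∀ P : Submodule F V, g • P = h • P := by
  obtain ⟨h, rfl⟩ := QuotientGroup.mk_surjective g
  exact ⟨h, fun _ => rfl⟩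

theorem finrank_smul (g : PGammaL F V) (P : Submodule F V) :
    Module.finrank F (g • P : Submodule F V) = Module.finrank F P := by
  obtain ⟨h, hh⟩ := exists_rep g
  rw [hh]
  obtain ⟨hadd, σ, hσ⟩ := h.2
  let e : P ≃+ (h • P : Submodule F V) :=
    { Equiv.Set.image (h : Equiv.Perm V) (P : Set V) (h : Equiv.Perm V).injective with
      map_add' := fun x y => Subtype.ext (hadd (x : V) y) }
  have := rank_eq_of_equiv_equiv σ e σ.bijective
    (fun c x => Subtype.ext (hσ c (x : V)))
  simp only [Module.finrank, this]

theorem smul_inf (g : PGammaL F V) (P Q : Submodule F V) :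
    g • (P ⊓ Q) = g • P ⊓ g • Q := by
  obtain ⟨h, hh⟩ := exists_rep g
  rw [hh, hh, hh]
  apply SetLike.coe_injective
  rw [Submodule.coe_inf, coe_smul, coe_smul, coe_smul, Submodule.coe_inf]
  exact Set.image_inter (h : Equiv.Perm V).injective

end SemilinearGroup

section Scheme

/-- The full automorphism group of a configuration `(X, {R i})`: the permutations `σ` of `X` for
which there is a permutation `π` of the index set such that `σ` carries `R i` onto `R (π i)` for
every `i`. When the `R i` partition `X × X`, it is the same to ask that
`R i x y` implies `R (π i) (σ x) (σ y)`. -/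
def schemeAut {X I : Type*} (R : I → X → X → Prop) : Subgroup (Equiv.Perm X) where
  carrier := {σ | ∃ π : Equiv.Perm I, ∀ i x y, R i x y ↔ R (π i) (σ x) (σ y)}
  one_mem' := ⟨1, fun _ _ _ => Iff.rfl⟩
  mul_mem' := by
    rintro σ τ ⟨π, hπ⟩ ⟨ρ, hρ⟩
    exact ⟨π * ρ, fun i x y => (hρ i x y).trans (hπ _ _ _)⟩
  inv_mem' := by
    rintro σ ⟨π, hπ⟩
    exact ⟨π⁻¹, fun i x y => by simpa using (hπ (π⁻¹ i) (σ⁻¹ x) (σ⁻¹ y)).symm⟩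

variable (F : Type*) [Field F] (n l m : ℕ)

/-- The subspace `E` spanned by the last `l` standard basis vectors of `F ^ (n + l)`. -/
def E : Submodule F (Fin (n + l) → F) :=
  Submodule.span F (Set.range fun i : Fin l => Pi.single (Fin.natAdd n i) (1 : F))

variable {F n l} in
/-- `P` is a subspace of type `(m, k)`. -/
def IsType (m k : ℕ) (P : Submodule F (Fin (n + l) → F)) : Prop :=
  Module.finrank F P = m ∧ Module.finrank F (P ⊓ E F n l : Submodule F (Fin (n + l) → F)) = k

/-- The set `X_m` of all subspaces of type `(m, 0)`. -/
def Vertex : Type _ := {P : Submodule F (Fin (n + l) → F) // IsType m 0 P}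

variable {F n l} in
/-- The subspace `P'` of `F ^ n` obtained from `P` by keeping the first `n` coordinates
of its vectors. -/
def front (P : Submodule F (Fin (n + l) → F)) : Submodule F (Fin n → F) :=
  P.map (LinearMap.funLeft F F (Fin.castAdd l))

/-- The pairs `(i, j)` for which the relation `R_{i, j - i}` is part of the scheme. -/
def Index : Type :=
  {p : ℕ × ℕ // p.1 ≤ min m (n - m) ∧ p.1 ≤ p.2 ∧ p.2 - p.1 ≤ min (m - p.1) (min p.2 l)}

/-- The relation `R_{i, j - i}`: `dim (P' ∩ Q') = m - i` and `dim (P ∩ Q) = m - j`. -/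
def rel (p : Index n l m) (P Q : Vertex F n l m) : Prop :=
  Module.finrank F (front P.1 ⊓ front Q.1 : Submodule F (Fin n → F)) + p.1.1 = m ∧
    Module.finrank F (P.1 ⊓ Q.1 : Submodule F (Fin (n + l) → F)) + p.1.2 = m

/-- The stabilizer of `E` in the projective semilinear group of `F ^ (n + l)`. -/
abbrev PGammaLStab : Subgroup (PGammaL F (Fin (n + l) → F)) :=
  MulAction.stabilizer (PGammaL F (Fin (n + l) → F)) (E F n l)

variable {F n l} in
theorem IsType.smul {m k : ℕ} (g : PGammaLStab F n l) {P : Submodule F (Fin (n + l) → F)}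
    (hP : IsType m k P) : IsType m k (g.1 • P) := by
  refine ⟨(finrank_smul g.1 P).trans hP.1, ?_⟩
  have hE : g.1 • E F n l = E F n l := g.2
  rw [← hP.2, ← finrank_smul g.1 (P ⊓ E F n l), smul_inf, hE]

/-- The stabilizer of `E` acts on `X_m` by taking images of subspaces. -/
instance instMulActionVertex : MulAction (PGammaLStab F n l) (Vertex F n l m) where
  smul g P := ⟨g.1 • P.1, P.2.smul g⟩
  one_smul P := Subtype.ext (one_smul _ P.1)
  mul_smul g h P := Subtype.ext (mul_smul g.1 h.1 P.1)

end Scheme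

end AttenuatedSpace

/-! The dimension of `P' ∩ Q'` equals that of `P ⊓ (Q ⊔ E)`, so the relation of a pair is encoded by
its `color`, and an automorphism of the scheme is a permutation σ of the vertices that respects
equality of colours. Semilinear maps fixing `E` preserve colours; the work lies in the converse.

Call two vertices cofibral (`Fib`) if they agree modulo `E`, and adjacent (`Adj`) if they meet in a
hyperplane of each without being cofibral. The pullback of `Fib` along σ is an equivalence relation
and a union of colour classes. Such a relation either lies inside `Fib` or relates everything
(`Trans.rel_of_color_invariant`), so σ preserves fibres. Adjacency can then be expressed through
fibres and equality of colours alone (`adj_iff_minTwin`), so σ preserves it too.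

For adjacent `P`, `Q`, the vertices through `P ⊓ Q` are recognisable from `Fib` and `Adj`
(`Adj.inf_le_iff`). Hence σ induces a permutation of the same kind one dimension lower
(`exists_descent`). Iteration ends at the points outside `E`, with collinearity preserved on lines
that miss `E` (`exists_point_perm`). A fundamental theorem of projective geometry for the space with
`E` removed (`Collineation.exists_gammaL`) then gives a semilinear map that induces the point
permutation, and therefore σ.

Faithfulness holds because a semilinear map that fixes every vertex fixes every point outside `E`,
which forces it to be scalar (`mem_scalars_of_smul_eq`). -/

namespace AttenuatedSpace

open Module Submodule

/-! ### Transversal subspaces, colours, and connectedness -/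

section Transversal

variable {F V : Type*} [Field F] [AddCommGroup V] [Module F V]

set_option linter.unusedSectionVars false

theorem sup_span_inf_eq {H A : Submodule F V} {x : V} (hx : x ∉ H ⊔ A) :
    (H ⊔ span F {x}) ⊓ A = H ⊓ A := by
  apply le_antisymm _ (inf_le_inf_right _ le_sup_left)
  rintro y ⟨hy, hyA⟩
  obtain ⟨h, hh, z, hz, rfl⟩ := mem_sup.1 hy
  obtain ⟨c, rfl⟩ := mem_span_singleton.1 hz
  obtain rfl | hc := eq_or_ne c 0
  · simp only [zero_smul, add_zero] at hyA ⊢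
    exact ⟨hh, hyA⟩
  · refine absurd ?_ hx
    have h1 : c • x ∈ H ⊔ A := by
      have := sub_mem (mem_sup_right hyA : _ ∈ H ⊔ A) (mem_sup_left hh)
      simpa using this
    simpa [smul_smul, hc] using smul_mem _ c⁻¹ h1

theorem exists_hyperplane {D P : Submodule F V} {x : V} (hD : D ≤ P) (hx : x ∈ P) (hxD : x ∉ D) :
    ∃ H, D ≤ H ∧ H ≤ P ∧ x ∉ H ∧ H ⊔ span F {x} = P := by
  obtain ⟨f, hfx, hf⟩ := exists_le_ker_of_notMem hxD
  refine ⟨P ⊓ LinearMap.ker f, le_inf hD hf, inf_le_left, fun h => hfx h.2, le_antisymm ?_ ?_⟩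
  · exact sup_le inf_le_left (by simpa using hx)
  · intro p hp
    rw [← sub_add_cancel p ((f p / f x) • x)]
    refine add_mem (mem_sup_left ⟨sub_mem hp (smul_mem _ _ hx), ?_⟩)
      (mem_sup_right (smul_mem _ _ (mem_span_singleton_self x)))
    simp [hfx]

variable [FiniteDimensional F V]

theorem finrank_sup_span_singleton {H : Submodule F V} {x : V} (hx : x ∉ H) :
    finrank F ↥(H ⊔ span F {x}) = finrank F H + 1 := by
  have h0 : x ≠ 0 := fun h => hx (h ▸ H.zero_mem)
  have h1 : H ⊓ span F {x} = ⊥ := by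
    rw [eq_bot_iff]
    rintro y ⟨hy, hz⟩
    obtain ⟨c, rfl⟩ := mem_span_singleton.1 hz
    obtain rfl | hc := eq_or_ne c 0
    · simp
    · exact absurd (by simpa [smul_smul, hc] using H.smul_mem c⁻¹ hy) hx
  have := finrank_sup_add_finrank_inf_eq H (span F {x})
  rw [h1, finrank_bot, finrank_span_singleton h0] at this
  simpa using this

theorem finrank_sup_of_inf_eq_bot {D E : Submodule F V} (h : D ⊓ E = ⊥) :
    finrank F ↥(D ⊔ E) = finrank F D + finrank F E := by
  have := finrank_sup_add_finrank_inf_eq D E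
  rwa [h, finrank_bot, add_zero] at this

/-- `P` has dimension `m` and meets `E` trivially. -/
structure IsTrans (E : Submodule F V) (m : ℕ) (P : Submodule F V) : Prop where
  finrank_eq : finrank F P = m
  inf_eq : P ⊓ E = ⊥

/-- The `m`-dimensional subspaces that meet `E` trivially. -/
abbrev Trans (E : Submodule F V) (m : ℕ) : Type _ := {P : Submodule F V // IsTrans E m P}

variable {E : Submodule F V} {m : ℕ} {P Q R : Submodule F V}

theorem IsTrans.eq_zero (hP : IsTrans E m P) {x : V} (hx : x ∈ P) (hxE : x ∈ E) : x = 0 := by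
  have : x ∈ P ⊓ E := ⟨hx, hxE⟩
  simpa [hP.inf_eq] using this

theorem IsTrans.finrank_sup (hP : IsTrans E m P) : finrank F ↥(P ⊔ E) = m + finrank F E := by
  rw [finrank_sup_of_inf_eq_bot hP.inf_eq, hP.finrank_eq]

theorem IsTrans.sup_span (hP : IsTrans E m P) {x : V} (hx : x ∉ P ⊔ E) :
    IsTrans E (m + 1) (P ⊔ span F {x}) where
  finrank_eq := by
    rw [finrank_sup_span_singleton fun h => hx (mem_sup_left h), hP.finrank_eq]
  inf_eq := by rw [sup_span_inf_eq hx, hP.inf_eq]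

theorem IsTrans.mono (hP : IsTrans E m P) {H : Submodule F V} (h : H ≤ P) :
    IsTrans E (finrank F H) H :=
  ⟨rfl, eq_bot_iff.2 ((inf_le_inf_right E h).trans hP.inf_eq.le)⟩

theorem IsTrans.eq_of_le (hP : IsTrans E m P) (hQ : IsTrans E m Q) (h : P ≤ Q) : P = Q :=
  Submodule.eq_of_le_of_finrank_eq h (hP.finrank_eq.trans hQ.finrank_eq.symm)

theorem IsTrans.sup_eq_of_le (hP : IsTrans E m P) (hQ : IsTrans E m Q) (h : P ≤ Q ⊔ E) :
    P ⊔ E = Q ⊔ E :=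
  Submodule.eq_of_le_of_finrank_eq (sup_le h le_sup_right) (hP.finrank_sup.trans hQ.finrank_sup.symm)

theorem finrank_hyperplane {H : Submodule F V} {x : V} (hP : finrank F P = m) (hx : x ∉ H)
    (h : H ⊔ span F {x} = P) : finrank F H + 1 = m := by
  rw [← hP, ← h, finrank_sup_span_singleton hx]

theorem finrank_inf_sup_sup (hP : P ⊓ E = ⊥) : finrank F ↥((P ⊔ E) ⊓ (Q ⊔ E)) =
    finrank F ↥(P ⊓ (Q ⊔ E)) + finrank F E := by
  have h : (P ⊔ E) ⊓ (Q ⊔ E) = (P ⊓ (Q ⊔ E)) ⊔ E := by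
    rw [sup_comm P, sup_inf_assoc_of_le P (le_sup_right : E ≤ Q ⊔ E), sup_comm E]
  rw [h, finrank_sup_of_inf_eq_bot]
  exact eq_bot_iff.2 ((inf_le_inf_right E inf_le_left).trans hP.le)

/-- The pair of dimensions that determines the relation of the scheme a pair of subspaces is in. -/
noncomputable def color (E P Q : Submodule F V) : ℕ × ℕ :=
  (finrank F ↥(P ⊓ (Q ⊔ E)), finrank F ↥(P ⊓ Q))

/-- Both entries of the colour depend only on the intersection with `P ⊔ E`, because `P ≤ P ⊔ E`; a
new vector outside `H ⊔ (P ⊔ E)` contributes nothing to that intersection. -/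
theorem color_sup_span {H : Submodule F V} {x : V} (h1 : Q ⊓ (P ⊔ E) ≤ H) (h2 : H ≤ Q)
    (hx : x ∉ H ⊔ (P ⊔ E)) : color E (H ⊔ span F {x}) P = color E Q P := by
  have h3 : (H ⊔ span F {x}) ⊓ (P ⊔ E) = Q ⊓ (P ⊔ E) := by
    rw [sup_span_inf_eq hx]
    exact le_antisymm (inf_le_inf_right _ h2) (le_inf h1 inf_le_right)
  have h4 : ∀ A : Submodule F V, A ⊓ P = A ⊓ (P ⊔ E) ⊓ P := fun A => by
    rw [inf_assoc, inf_eq_right.2 (le_sup_left : P ≤ P ⊔ E)]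
  rw [color, color, h3, h4 (H ⊔ span F {x}), h3, ← h4]

theorem exists_hyperplane_notMem (hQ : ¬ Q ≤ P ⊔ E) :
    ∃ H, ∃ q ∈ Q, Q ⊓ (P ⊔ E) ≤ H ∧ H ≤ Q ∧ q ∉ H ⊔ (P ⊔ E) ∧ H ⊔ span F {q} = Q := by
  obtain ⟨q, hq, hqP⟩ := SetLike.not_le_iff_exists.1 hQ
  obtain ⟨H, h1, h2, h3, h4⟩ := exists_hyperplane (D := Q ⊓ (P ⊔ E)) inf_le_left hq
    (fun h => hqP h.2)
  refine ⟨H, q, hq, h1, h2, fun h => ?_, h4⟩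
  obtain ⟨y, hy, z, hz, rfl⟩ := mem_sup.1 h
  have : z ∈ Q := by simpa using sub_mem hq (h2 hy)
  exact h3 (add_mem hy (h1 ⟨this, hz⟩))

/-- Moving a subspace one step towards another one. -/
theorem exists_step (hP : IsTrans E m P) (hQ : IsTrans E m Q) (hPQ : P ≠ Q) :
    ∃ R, IsTrans E m R ∧ finrank F ↥(P ⊓ R) + 1 = m ∧
      finrank F ↥(P ⊓ Q) < finrank F ↥(R ⊓ Q) := by
  -- An exchange: `p` is dropped and `q` added, and the last clause keeps the result transversal to
  -- `E`. If `Q ≤ P ⊔ E`, then `p` must be the `P`-component of `q`; otherwise `q` is taken outside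
  -- `P ⊔ E` and any `p` outside `Q` will do.
  have key : ∃ p ∈ P, p ∉ Q ∧ ∃ q ∈ Q, q ∉ P ∧ ∀ H ≤ P, p ∉ H → q ∉ H ⊔ E := by
    by_cases h : Q ≤ P ⊔ E
    · obtain ⟨q, hq, hqP⟩ := SetLike.not_le_iff_exists.1 fun h' => hPQ (hQ.eq_of_le hP h').symm
      obtain ⟨p, hp, e, he, rfl⟩ := mem_sup.1 (h hq)
      refine ⟨p, hp, fun hpQ => hqP ?_, _, hq, hqP, fun H hH hpH hH' => ?_⟩
      · have : e = 0 := hQ.eq_zero (by simpa using sub_mem hq hpQ) he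
        simpa [this] using hp
      · obtain ⟨x, hx, e', he', hxe⟩ := mem_sup.1 hH'
        have h1 : p - x = e' - e := by rw [sub_eq_sub_iff_add_eq_add, ← hxe, add_comm]
        have h2 : p - x = 0 := hP.eq_zero (sub_mem hp (hH hx)) (h1 ▸ sub_mem he' he)
        exact hpH (by rwa [sub_eq_zero.1 h2])
    · obtain ⟨q, hq, hqP⟩ := SetLike.not_le_iff_exists.1 h
      obtain ⟨p, hp, hpQ⟩ := SetLike.not_le_iff_exists.1 fun h' => hPQ (hP.eq_of_le hQ h')
      exact ⟨p, hp, hpQ, q, hq, fun h => hqP (mem_sup_left h),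
        fun H hH _ h => hqP (sup_le_sup_right hH E h)⟩
  obtain ⟨p, hp, hpQ, q, hq, hqP, key⟩ := key
  obtain ⟨H, h1, h2, h3, h4⟩ := exists_hyperplane (D := P ⊓ Q) inf_le_left hp (fun h => hpQ h.2)
  have hH := finrank_hyperplane hP.finrank_eq h3 h4
  have hR := (hP.mono h2).sup_span (key H h2 h3)
  rw [hH] at hR
  refine ⟨_, hR, ?_, ?_⟩
  · rw [inf_comm, sup_span_inf_eq (by rwa [sup_eq_right.2 h2]), inf_eq_left.2 h2, hH]
  · rw [← Nat.add_one_le_iff, ← finrank_sup_span_singleton fun h : q ∈ P ⊓ Q => hqP h.1]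
    exact finrank_mono (sup_le (le_inf (h1.trans le_sup_left) inf_le_right)
      ((span_singleton_le_iff_mem _ _).2 ⟨mem_sup_right (mem_span_singleton_self q), hq⟩))

/-- The graph of pairs meeting in a hyperplane is connected: each `exists_step` increases the
intersection with the target. -/
theorem Trans.induction_step {r : Trans E m → Trans E m → Prop} (hr : Equivalence r)
    (h : ∀ P Q : Trans E m, finrank F ↥(P.1 ⊓ Q.1) + 1 = m → r P Q) (P Q : Trans E m) : r P Q := by
  induction hk : m - finrank F ↥(P.1 ⊓ Q.1) using Nat.strong_induction_on generalizing P with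
  | _ k ih =>
    by_cases hPQ : P = Q
    · exact hPQ ▸ hr.refl P
    obtain ⟨R, hR, h1, h2⟩ := exists_step P.2 Q.2 (fun h => hPQ (Subtype.ext h))
    have h3 : finrank F ↥(R ⊓ Q.1) ≤ m :=
      (finrank_mono (inf_le_left : R ⊓ Q.1 ≤ R)).trans hR.finrank_eq.le
    exact hr.trans (h P ⟨R, hR⟩ h1) (ih _ (by dsimp only; omega) ⟨R, hR⟩ rfl)

/-- An equivalence relation that is a union of relations of the scheme and relates two subspaces
with distinct projections relates all subspaces. -/
theorem Trans.rel_of_color_invariant (hE : E ≠ ⊥) {r : Trans E m → Trans E m → Prop}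
    (hr : Equivalence r)
    (hc : ∀ P Q R S : Trans E m, color E P.1 Q.1 = color E R.1 S.1 → r P Q → r R S)
    {P Q : Trans E m} (hPQ : r P Q) (h : P.1 ⊔ E ≠ Q.1 ⊔ E) (R S : Trans E m) : r R S := by
  obtain ⟨H, q, hq, h1, h2, h3, h4⟩ :=
    exists_hyperplane_notMem fun h' => h (Q.2.sup_eq_of_le P.2 h').symm
  have hqH : q ∉ H := fun h => h3 (mem_sup_left h)
  have hH := finrank_hyperplane Q.2.finrank_eq hqH h4
  -- Such a `T` has the same colour with `P` as `Q` has, so `T` and `Q` are related through `P`.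
  have hx : ∀ x, x ∉ H ⊔ (P.1 ⊔ E) → ∃ T : Trans E m, T.1 = H ⊔ span F {x} ∧ r T Q := by
    intro x hx
    have h5 := (Q.2.mono h2).sup_span fun h => hx (sup_le_sup_left le_sup_right H h)
    rw [hH] at h5
    refine ⟨⟨_, h5⟩, rfl, hr.trans (hc Q P _ P ?_ (hr.symm hPQ)) hPQ⟩
    exact (color_sup_span h1 h2 hx).symm
  have hadd : ∀ y ∈ P.1 ⊔ E, q + y ∉ H ⊔ (P.1 ⊔ E) := fun y hy h =>
    h3 (by simpa using sub_mem h (mem_sup_right hy))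
  obtain ⟨e, he, he0⟩ := exists_mem_ne_zero_of_ne_bot hE
  obtain ⟨p, hp, hpQ⟩ := SetLike.not_le_iff_exists.1 fun h' => h (P.2.sup_eq_of_le Q.2 h')
  -- Both `T` and `U` meet `Q` in `H`, but `T` is in the fibre of `Q` and `U` is not. These realise
  -- the only two colours possible for a pair meeting in a hyperplane, so connectedness finishes the
  -- proof.
  obtain ⟨T, hT, hTr⟩ := hx _ (hadd e (mem_sup_right he))
  obtain ⟨U, hU, hUr⟩ := hx _ (hadd p (mem_sup_left hp))
  have cT : color E T.1 Q.1 = (m, finrank F H) := by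
    rw [color]
    congr 1
    · rw [inf_eq_left.2, T.2.finrank_eq]
      rw [hT]
      exact sup_le (h2.trans le_sup_left)
        (by simpa using add_mem (mem_sup_left hq) (mem_sup_right he))
    · rw [hT, sup_span_inf_eq, inf_eq_left.2 h2]
      rw [sup_eq_right.2 h2]
      exact fun h => he0 (Q.2.eq_zero (by simpa using sub_mem h hq) he)
  have hpx : q + p ∉ Q.1 ⊔ E := fun h => hpQ (by simpa using sub_mem h (mem_sup_left hq))
  have cU : color E U.1 Q.1 = (finrank F H, finrank F H) := by
    rw [color]
    congr 1
    · rw [hU, sup_span_inf_eq, inf_eq_left.2 (h2.trans le_sup_left)]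
      rwa [sup_eq_right.2 (h2.trans le_sup_left)]
    · rw [hU, sup_span_inf_eq, inf_eq_left.2 h2]
      rw [sup_eq_right.2 h2]
      exact fun h => hpx (mem_sup_left h)
  refine Trans.induction_step hr (fun A B hAB => ?_) R S
  have h6 : finrank F ↥(A.1 ⊓ B.1) ≤ finrank F ↥(A.1 ⊓ (B.1 ⊔ E)) :=
    finrank_mono (inf_le_inf_left _ le_sup_left)
  have h7 : finrank F ↥(A.1 ⊓ (B.1 ⊔ E)) ≤ m :=
    (finrank_mono inf_le_left).trans A.2.finrank_eq.le
  obtain h8 | h8 : finrank F ↥(A.1 ⊓ (B.1 ⊔ E)) = m ∨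
      finrank F ↥(A.1 ⊓ (B.1 ⊔ E)) = finrank F H := by omega
  · exact hc T Q A B (by rw [cT, color, h8]; congr 1; omega) hTr
  · exact hc U Q A B (by rw [cU, color, h8]; congr 1; omega) hUr

end Transversal

/-! ### Recovering fibres and adjacency from equality of colours -/

section Adjacency

set_option linter.unusedSectionVars false

variable {F V : Type*} [Field F] [AddCommGroup V] [Module F V] [FiniteDimensional F V]
  {E : Submodule F V} {m : ℕ}

/-- Two subspaces have the same image modulo `E`. -/
def Fib (P Q : Trans E m) : Prop := P.1 ⊔ E = Q.1 ⊔ E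

/-- Two subspaces meet in a hyperplane of each and have distinct images modulo `E`. -/
def Adj (P Q : Trans E m) : Prop := finrank F ↥(P.1 ⊓ Q.1) + 1 = m ∧ ¬ Fib P Q

variable {P Q R : Trans E m}

theorem Fib.symm (h : Fib P Q) : Fib Q P := Eq.symm h

theorem Fib.trans (h : Fib P Q) (h' : Fib Q R) : Fib P R := Eq.trans h h'

theorem Adj.symm (h : Adj P Q) : Adj Q P := ⟨by rw [inf_comm, h.1], fun h' => h.2 h'.symm⟩

theorem fib_iff_inf_sup : Fib P Q ↔ finrank F ↥(P.1 ⊓ (Q.1 ⊔ E)) = m := by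
  constructor
  · intro h
    rw [inf_eq_left.2, P.2.finrank_eq]
    exact le_sup_left.trans h.le
  · intro h
    apply P.2.sup_eq_of_le Q.2
    rw [← inf_eq_left]
    exact Submodule.eq_of_le_of_finrank_eq inf_le_left (h.trans P.2.finrank_eq.symm)

theorem color_eq_iff {P Q R S : Submodule F V} : color E P Q = color E R S ↔
    finrank F ↥(P ⊓ (Q ⊔ E)) = finrank F ↥(R ⊓ (S ⊔ E)) ∧
      finrank F ↥(P ⊓ Q) = finrank F ↥(R ⊓ S) := Prod.ext_iff

theorem fib_iff_of_color_eq {S : Trans E m}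
    (h : color E P.1 Q.1 = color E R.1 S.1) : Fib P Q ↔ Fib R S := by
  rw [fib_iff_inf_sup, fib_iff_inf_sup, (color_eq_iff.1 h).1]

theorem inf_sup_lt (h : ¬ Fib P Q) : finrank F ↥(P.1 ⊓ (Q.1 ⊔ E)) + 1 ≤ m := by
  have h1 : finrank F ↥(P.1 ⊓ (Q.1 ⊔ E)) ≤ m :=
    (finrank_mono inf_le_left).trans P.2.finrank_eq.le
  have := mt fib_iff_inf_sup.2 h
  omega

theorem adj_of_le {W : Submodule F V} (hP : W ≤ P.1) (hQ : W ≤ Q.1) (hW : finrank F W + 1 = m)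
    (h : ¬ Fib P Q) : Adj P Q := by
  refine ⟨?_, h⟩
  have h1 := inf_sup_lt h
  have h2 : finrank F W ≤ finrank F ↥(P.1 ⊓ Q.1) := finrank_mono (le_inf hP hQ)
  have h3 : finrank F ↥(P.1 ⊓ Q.1) ≤ finrank F ↥(P.1 ⊓ (Q.1 ⊔ E)) :=
    finrank_mono (inf_le_inf_left _ le_sup_left)
  omega

theorem inf_eq_of_le {W : Submodule F V} (hP : W ≤ P.1) (hQ : W ≤ Q.1) (hW : finrank F W + 1 = m)
    (h : ¬ Fib P Q) : P.1 ⊓ Q.1 = W := by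
  have := (adj_of_le hP hQ hW h).1
  exact (Submodule.eq_of_le_of_finrank_eq (le_inf hP hQ) (by omega)).symm

theorem Adj.inf_sup_eq (h : Adj P Q) : P.1 ⊓ (Q.1 ⊔ E) = P.1 ⊓ Q.1 := by
  have h1 := inf_sup_lt h.2
  have h2 := h.1
  exact (Submodule.eq_of_le_of_finrank_le (inf_le_inf_left _ le_sup_left) (by omega)).symm

theorem Adj.color_eq (h : Adj P Q) : color E P.1 Q.1 = (m - 1, m - 1) := by
  have := h.1
  rw [color, h.inf_sup_eq]
  congr 1 <;> omega

theorem Adj.of_color_eq {R S : Trans E m} (h : Adj P Q)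
    (hc : color E R.1 S.1 = color E P.1 Q.1) : Adj R S :=
  ⟨by rw [(color_eq_iff.1 hc).2, h.1], mt (fib_iff_of_color_eq hc).1 h.2⟩

theorem inf_sup_sup_eq (P Q : Submodule F V) : P ⊓ (Q ⊔ E) ⊔ E = (P ⊔ E) ⊓ (Q ⊔ E) := by
  rw [sup_comm P, sup_inf_assoc_of_le P (le_sup_right : E ≤ Q ⊔ E), sup_comm E]

theorem sup_inf_of_le {W : Submodule F V} (hW : W ≤ P.1) : (W ⊔ E) ⊓ P.1 = W := by
  rw [sup_inf_assoc_of_le E hW, inf_comm, P.2.inf_eq, sup_bot_eq]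

/-- For adjacent `P`, `Q`, the sum of `P ⊓ Q` with `E` is `(P ⊔ E) ⊓ (Q ⊔ E)`, which depends only on
the fibres; intersecting it with `Q` gives back `P ⊓ Q`. -/
theorem Adj.inf_eq_of_fib (h : Adj P Q) (hR : Fib R P) (h' : Adj R Q) : R.1 ⊓ Q.1 = P.1 ⊓ Q.1 := by
  rw [← sup_inf_of_le (P := Q) (W := R.1 ⊓ Q.1) inf_le_right, ← h'.inf_sup_eq,
    inf_sup_sup_eq, hR, ← inf_sup_sup_eq, h.inf_sup_eq, sup_inf_of_le inf_le_right]

theorem color_eq_of_inf_le (hR : Fib R P) (h : P.1 ⊓ (Q.1 ⊔ E) ≤ R.1) :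
    color E R.1 Q.1 = color E P.1 Q.1 := by
  have h1 : P.1 ⊓ (Q.1 ⊔ E) = R.1 ⊓ (Q.1 ⊔ E) := by
    rw [← sup_inf_of_le h, inf_sup_sup_eq, ← hR, ← inf_sup_sup_eq, sup_inf_of_le inf_le_left]
  have h4 : ∀ A : Submodule F V, A ⊓ Q.1 = A ⊓ (Q.1 ⊔ E) ⊓ Q.1 := fun A => by
    rw [inf_assoc, inf_eq_right.2 (le_sup_left : Q.1 ≤ Q.1 ⊔ E)]
  rw [color, color, h1, h4 R.1, ← h1, ← h4]

/-- Tilting: keep a hyperplane of `P` through `D` and replace `w` by `w + e` with `e ≠ 0` in `E`. -/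
theorem exists_fib_notMem (hE : E ≠ ⊥) {D : Submodule F V} {w : V} (hD : D ≤ P.1) (hw : w ∈ P.1)
    (hwD : w ∉ D) : ∃ R : Trans E m, Fib R P ∧ D ≤ R.1 ∧ w ∉ R.1 := by
  obtain ⟨e, he, he0⟩ := exists_mem_ne_zero_of_ne_bot hE
  obtain ⟨H, h1, h2, h3, h4⟩ := exists_hyperplane hD hw hwD
  have hH := finrank_hyperplane P.2.finrank_eq h3 h4
  have h5 : w + e ∉ H ⊔ E := fun h => h3 <| by
    rw [← sup_inf_of_le h2]
    exact ⟨by simpa using sub_mem h (mem_sup_right he), hw⟩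
  have hR := (P.2.mono h2).sup_span h5
  rw [hH] at hR
  refine ⟨⟨_, hR⟩, hR.sup_eq_of_le P.2 (sup_le (h2.trans le_sup_left) ?_), h1.trans le_sup_left, ?_⟩
  · exact (span_singleton_le_iff_mem _ _).2 (add_mem (mem_sup_left hw) (mem_sup_right he))
  · intro h
    have h6 : w ∈ (H ⊔ span F {w + e}) ⊓ P.1 := ⟨h, hw⟩
    rw [sup_span_inf_eq, inf_eq_left.2 h2] at h6
    · exact h3 h6
    · rw [sup_eq_right.2 h2]
      exact fun h => he0 (P.2.eq_zero (by simpa using sub_mem h hw) he)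

theorem exists_notMem_of_finrank_lt {A : Submodule F V} (h : finrank F A < finrank F V) :
    ∃ x, x ∉ A := by
  by_contra! h'
  rw [eq_top_iff'.2 h', finrank_top] at h
  exact h.false

theorem exists_adj_inf_eq (hn : m + finrank F E < finrank F V) {W : Submodule F V} (hW : W ≤ P.1)
    (hWm : finrank F W + 1 = m) : ∃ Q : Trans E m, Adj P Q ∧ P.1 ⊓ Q.1 = W := by
  obtain ⟨x, hx⟩ := exists_notMem_of_finrank_lt (P.2.finrank_sup.trans_lt hn)
  have hQ := (P.2.mono hW).sup_span fun h => hx (sup_le_sup_right hW E h)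
  rw [hWm] at hQ
  have hf : ¬ Fib P ⟨_, hQ⟩ := fun h => hx <| by
    rw [h]
    exact mem_sup_left (mem_sup_right (mem_span_singleton_self x))
  exact ⟨⟨_, hQ⟩, adj_of_le hW le_sup_left hWm hf, inf_eq_of_le hW le_sup_left hWm hf⟩

theorem exists_not_fib (hm : 0 < m) (hn : m + finrank F E < finrank F V) (P : Trans E m) :
    ∃ Q : Trans E m, ¬ Fib P Q := by
  have : P.1 ≠ ⊥ := fun h => by
    have := P.2.finrank_eq
    rw [h, finrank_bot] at this
    omega
  obtain ⟨x, hx, hx0⟩ := exists_mem_ne_zero_of_ne_bot this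
  obtain ⟨H, -, h2, h3, h4⟩ := exists_hyperplane bot_le hx (by simpa using hx0)
  obtain ⟨Q, hQ, -⟩ := exists_adj_inf_eq hn h2 (finrank_hyperplane P.2.finrank_eq h3 h4)
  exact ⟨Q, hQ.2⟩

/-- If the pullback of `Fib` along σ related vertices of different fibres, it would relate all
vertices, so there would be only one fibre. -/
theorem fib_of_fib_apply (hE : E ≠ ⊥) (hm : 0 < m) (hn : m + finrank F E < finrank F V)
    (σ : Equiv.Perm (Trans E m))
    (hσ : ∀ P Q R S, color E P.1 Q.1 = color E R.1 S.1 →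
      color E (σ P).1 (σ Q).1 = color E (σ R).1 (σ S).1)
    (h : Fib (σ P) (σ Q)) : Fib P Q := by
  by_contra hPQ
  obtain ⟨S, hS⟩ := exists_not_fib hm hn P
  apply hS
  have := Trans.rel_of_color_invariant hE (r := fun P Q => Fib (σ P) (σ Q))
    ⟨fun _ => rfl, fun h => h.symm, fun h h' => h.trans h'⟩
    (fun P Q R S hc => (fib_iff_of_color_eq (hσ P Q R S hc)).1) h hPQ (σ.symm P) (σ.symm S)
  simpa using this

/-- `A` has the same image modulo `E` as `P`, and is in the same relation with `Q` as `P`. -/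
def Twin (P Q A : Trans E m) : Prop := Fib A P ∧ color E A.1 Q.1 = color E P.1 Q.1

/-- The set of twins is minimal. -/
def MinTwin (P Q : Trans E m) : Prop :=
  ∀ R, ¬ Fib P R → (∀ A, Twin P R A → Twin P Q A) → ∀ A, Twin P Q A → Twin P R A

/-- A twin is again adjacent to `Q`, and cofibral neighbours of `Q` meet `Q` in the same subspace.
-/
theorem Adj.twin_iff (h : Adj P Q) {A : Trans E m} : Twin P Q A ↔ Fib A P ∧ P.1 ⊓ Q.1 ≤ A.1 := by
  refine and_congr_right fun hA => ⟨fun hc => ?_, fun hle => ?_⟩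
  · rw [← h.inf_eq_of_fib hA (h.of_color_eq hc)]
    exact inf_le_left
  · exact color_eq_of_inf_le hA (by rwa [h.inf_sup_eq])

theorem twin_of_inf_le {A : Trans E m} (hA : Fib A P) (h : P.1 ⊓ (Q.1 ⊔ E) ≤ A.1) : Twin P Q A :=
  ⟨hA, color_eq_of_inf_le hA h⟩

/-- Every member of the fibre through `P ⊓ (R ⊔ E)` is a twin, and by tilting these have no further
vector of `P` in common. -/
theorem le_inf_sup_of_twin_le (hE : E ≠ ⊥) {W : Submodule F V} (hW : W ≤ P.1)
    (h : ∀ A, Twin P R A → W ≤ A.1) : W ≤ P.1 ⊓ (R.1 ⊔ E) := by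
  intro w hw
  by_contra hwD
  obtain ⟨A, hA, hDA, hwA⟩ := exists_fib_notMem hE inf_le_left (hW hw) hwD
  exact hwA (h A (twin_of_inf_le hA hDA) hw)

theorem Adj.minTwin (hE : E ≠ ⊥) (h : Adj P Q) : MinTwin P Q := by
  intro R hR hsub A hA
  have h1 := le_inf_sup_of_twin_le hE inf_le_left fun A hA => (h.twin_iff.1 (hsub A hA)).2
  have h2 := inf_sup_lt hR
  have h3 := h.1
  have h4 := Submodule.eq_of_le_of_finrank_le h1 (by omega)
  exact twin_of_inf_le hA.1 (h4 ▸ (h.twin_iff.1 hA).2)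

/-- Minimality is tested against a neighbour `R` of `P` with `P ⊓ R` a hyperplane of `P` that
contains `P ⊓ (Q ⊔ E)`: equal twin sets force the two subspaces to coincide. -/
theorem MinTwin.inf_sup_le (hE : E ≠ ⊥) (hn : m + finrank F E < finrank F V) (h : MinTwin P Q)
    (hPQ : ¬ Fib P Q) : finrank F ↥(P.1 ⊓ (Q.1 ⊔ E)) + 1 = m ∧
      ∀ A, Twin P Q A → P.1 ⊓ (Q.1 ⊔ E) ≤ A.1 := by
  obtain ⟨x, hx, hxD⟩ := SetLike.not_le_iff_exists.1 fun h : P.1 ≤ Q.1 ⊔ E =>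
    hPQ (P.2.sup_eq_of_le Q.2 h)
  obtain ⟨H, h1, h2, h3, h4⟩ := exists_hyperplane (D := P.1 ⊓ (Q.1 ⊔ E)) inf_le_left hx
    (fun h => hxD h.2)
  have hH := finrank_hyperplane P.2.finrank_eq h3 h4
  obtain ⟨R, hR, hRW⟩ := exists_adj_inf_eq hn h2 hH
  have h5 := h R hR.2 fun A hA => twin_of_inf_le hA.1 (h1.trans (hRW ▸ (hR.twin_iff.1 hA).2))
  have h6 : ∀ A, Twin P Q A → H ≤ A.1 := fun A hA => hRW ▸ (hR.twin_iff.1 (h5 A hA)).2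
  have h7 := le_antisymm h1 (le_inf_sup_of_twin_le hE h2 h6)
  rw [h7]
  exact ⟨hH, h6⟩

theorem Adj.exists_third (h : Adj P Q) :
    ∃ R : Trans E m, ¬ Fib P R ∧ ¬ Fib R Q ∧ P.1 ⊓ Q.1 ≤ R.1 := by
  obtain ⟨p, hp, hpQ⟩ := SetLike.not_le_iff_exists.1 fun h' => h.2 (P.2.sup_eq_of_le Q.2 h')
  obtain ⟨q, hq, hqP⟩ := SetLike.not_le_iff_exists.1 fun h' => h.2 (Q.2.sup_eq_of_le P.2 h').symm
  have h1 : p + q ∉ P.1 ⊔ E := fun h => hqP (by simpa using sub_mem h (mem_sup_left hp))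
  have h2 : p + q ∉ Q.1 ⊔ E := fun h => hpQ (by simpa using sub_mem h (mem_sup_left hq))
  have hR := (P.2.mono (inf_le_left : P.1 ⊓ Q.1 ≤ P.1)).sup_span fun h => h1 (sup_le_sup_right inf_le_left E h)
  rw [h.1] at hR
  have h3 : p + q ∈ P.1 ⊓ Q.1 ⊔ span F {p + q} := mem_sup_right (mem_span_singleton_self _)
  refine ⟨⟨_, hR⟩, fun h' => h1 ?_, fun h' => h2 ?_, le_sup_left⟩
  · rw [h']
    exact mem_sup_left h3
  · rw [← h']
    exact mem_sup_left h3

/-- Minimality alone does not give adjacency. Over the field of two elements with `dim E = 1` and `m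
= 2`, the line `W = P ⊓ (Q ⊔ E)` of vectors and `Q ⊓ (W ⊔ E)` may be the two distinct complements of
`E` in `W ⊔ E`, and then every twin still contains `W`. The third vertex `R` excludes this. -/
theorem MinTwin.adj (hE : E ≠ ⊥) (hn : m + finrank F E < finrank F V) (h : MinTwin P Q)
    (hPQ : ¬ Fib P Q) (hPR : ¬ Fib P R) (hc : color E P.1 R.1 = color E P.1 Q.1)
    (hc' : color E R.1 Q.1 = color E P.1 Q.1) (hT : ∀ A, Twin P R A ↔ Twin P Q A) : Adj P Q := by
  obtain ⟨h1, h2⟩ := h.inf_sup_le hE hn hPQ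
  have hR : MinTwin P R := fun S hS hsub A hA =>
    h S hS (fun A hA => (hT A).1 (hsub A hA)) A ((hT A).1 hA)
  obtain ⟨h3, h4⟩ := hR.inf_sup_le hE hn hPR
  have h5 : P.1 ⊓ (Q.1 ⊔ E) = P.1 ⊓ (R.1 ⊔ E) :=
    Submodule.eq_of_le_of_finrank_eq
      (le_inf_sup_of_twin_le hE inf_le_left fun A hA => h2 A ((hT A).1 hA)) (by omega)
  obtain ⟨W, hW⟩ : ∃ W, P.1 ⊓ (Q.1 ⊔ E) = W := ⟨_, rfl⟩
  have hWR : W ⊔ E ≤ R.1 ⊔ E := sup_le (hW ▸ h5 ▸ inf_le_right) le_sup_right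
  have hWQ : W ⊔ E ≤ Q.1 ⊔ E := sup_le (hW ▸ inf_le_right) le_sup_right
  have hWP : W ≤ P.1 := hW ▸ inf_le_left
  rw [hW] at h1 h2
  have hWE : W ⊓ E = ⊥ := (P.2.mono hWP).inf_eq
  have hWf := finrank_sup_of_inf_eq_bot hWE
  have hPQW : (P.1 ⊔ E) ⊓ (Q.1 ⊔ E) = W ⊔ E := by rw [← inf_sup_sup_eq, hW]
  have hRQW : (R.1 ⊔ E) ⊓ (Q.1 ⊔ E) = W ⊔ E := by
    refine (Submodule.eq_of_le_of_finrank_eq (le_inf hWR hWQ) ?_).symm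
    rw [finrank_inf_sup_sup R.2.inf_eq, (color_eq_iff.1 hc').1, hWf, hW]
  have hR0 : R.1 ⊓ (W ⊔ E) ⊔ E = W ⊔ E := by rw [inf_sup_sup_eq, inf_eq_right.2 hWR]
  have hR0t := R.2.mono (inf_le_left : R.1 ⊓ (W ⊔ E) ≤ R.1)
  have hR0m : finrank F ↥(R.1 ⊓ (W ⊔ E)) + 1 = m := by
    have := hR0t.finrank_sup
    rw [hR0] at this
    omega
  obtain ⟨x, hx, hxW⟩ := SetLike.not_le_iff_exists.1 fun h : P.1 ≤ W => by
    have := finrank_mono h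
    rw [P.2.finrank_eq] at this
    omega
  have hxWE : x ∉ W ⊔ E := fun h => hxW (sup_inf_of_le hWP ▸ ⟨h, hx⟩)
  -- This vertex lies in the fibre of `P` but meets `W ⊔ E` where `R` does, so it has the colour of
  -- `R` with `Q`. It is thus a twin of `P` and contains `W`, whence `W ≤ R`; so `P` is adjacent to
  -- `R`, and by equality of colours to `Q`.
  have hA := hR0t.sup_span (x := x) (by rwa [hR0])
  rw [hR0m] at hA
  have hAW : (R.1 ⊓ (W ⊔ E) ⊔ span F {x}) ⊓ (W ⊔ E) = R.1 ⊓ (W ⊔ E) := by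
    rw [sup_span_inf_eq (by rwa [sup_eq_right.2 inf_le_right]), inf_eq_left.2 inf_le_right]
  have hAP : Fib ⟨_, hA⟩ P := hA.sup_eq_of_le P.2 (sup_le
    (inf_le_right.trans (sup_le_sup_right hWP E))
    ((span_singleton_le_iff_mem _ _).2 (mem_sup_left hx)))
  have hin : ∀ {A : Submodule F V}, (A ⊔ E) ⊓ (Q.1 ⊔ E) = W ⊔ E →
      A ⊓ Q.1 = A ⊓ (W ⊔ E) ⊓ Q.1 := fun {A} h => by
    apply le_antisymm
    · refine le_inf (le_inf inf_le_left ?_) inf_le_right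
      rw [← h]
      exact inf_le_inf le_sup_left le_sup_left
    · exact inf_le_inf_right _ inf_le_left
  have hAQ : Twin P Q ⟨_, hA⟩ := by
    refine ⟨hAP, ?_⟩
    rw [← hc']
    have h6 : ((R.1 ⊓ (W ⊔ E) ⊔ span F {x}) ⊔ E) ⊓ (Q.1 ⊔ E) = W ⊔ E := by
      exact (congrArg (· ⊓ (Q.1 ⊔ E)) hAP).trans hPQW
    have h7 := finrank_inf_sup_sup (Q := Q.1) hA.inf_eq
    have h8 := finrank_inf_sup_sup (Q := Q.1) R.2.inf_eq
    rw [h6] at h7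
    rw [hRQW] at h8
    rw [color, color]
    congr 1
    · dsimp only
      omega
    · dsimp only
      rw [hin h6, hAW, ← hin hRQW]
  have h9 : W ≤ R.1 := by
    have := le_inf (h2 _ hAQ) (le_sup_left : W ≤ W ⊔ E)
    exact (this.trans hAW.le).trans inf_le_left
  exact (adj_of_le hWP h9 h1 hPR).of_color_eq hc.symm

/-- The right-hand side involves only `Fib` and equality of colours, so σ preserves it. For adjacent
`P`, `Q` the witness `R` is a third vertex through `P ⊓ Q`, in a new fibre. -/
theorem adj_iff_minTwin (hE : E ≠ ⊥) (hn : m + finrank F E < finrank F V) :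
    Adj P Q ↔ ¬ Fib P Q ∧ MinTwin P Q ∧ ∃ R, ¬ Fib P R ∧ color E P.1 R.1 = color E P.1 Q.1 ∧
      color E R.1 Q.1 = color E P.1 Q.1 ∧ ∀ A, Twin P R A ↔ Twin P Q A := by
  constructor
  · intro h
    obtain ⟨R, h1, h2, h3⟩ := h.exists_third
    have h4 := adj_of_le inf_le_left h3 h.1 h1
    have h5 := adj_of_le h3 inf_le_right h.1 h2
    refine ⟨h.2, h.minTwin hE, R, h1, by rw [h.color_eq, h4.color_eq],
      by rw [h.color_eq, h5.color_eq], fun A => ?_⟩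
    rw [h.twin_iff, h4.twin_iff, inf_eq_of_le inf_le_left h3 h.1 h1]
  · rintro ⟨h1, h2, R, h3, h4, h5, h6⟩
    exact h2.adj hE hn h1 h3 h4 h5 h6

/-- A permutation that permutes the relations of the scheme preserves equality of images modulo
`E` and adjacency. -/
theorem fib_and_adj_apply_iff (hE : E ≠ ⊥) (hm : 0 < m) (hn : m + finrank F E < finrank F V)
    (σ : Equiv.Perm (Trans E m))
    (hσ : ∀ P Q R S, color E P.1 Q.1 = color E R.1 S.1 ↔
      color E (σ P).1 (σ Q).1 = color E (σ R).1 (σ S).1) :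
    (∀ P Q, Fib (σ P) (σ Q) ↔ Fib P Q) ∧ ∀ P Q, Adj (σ P) (σ Q) ↔ Adj P Q := by
  have hF : ∀ P Q, Fib (σ P) (σ Q) ↔ Fib P Q := fun P Q =>
    ⟨fib_of_fib_apply hE hm hn σ fun P Q R S => (hσ P Q R S).1, fun h =>
      fib_of_fib_apply hE hm hn σ.symm
        (fun P Q R S h => (hσ _ _ _ _).2 (by simpa using h)) (by simpa using h)⟩
  refine ⟨hF, fun P Q => ?_⟩
  have hT : ∀ P Q A, Twin (σ P) (σ Q) (σ A) ↔ Twin P Q A := fun P Q A =>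
    and_congr (hF A P) (hσ A Q P Q).symm
  have hM : MinTwin P Q ↔ MinTwin (σ P) (σ Q) :=
    σ.forall_congr fun R => imp_congr (not_congr (hF P R).symm) <| imp_congr
      (σ.forall_congr fun A => imp_congr (hT P R A).symm (hT P Q A).symm)
      (σ.forall_congr fun A => imp_congr (hT P Q A).symm (hT P R A).symm)
  rw [adj_iff_minTwin hE hn, adj_iff_minTwin hE hn, ← hM, hF]
  refine and_congr_right fun _ => and_congr_right fun _ => (σ.exists_congr fun R => ?_).symm
  exact and_congr (not_congr (hF P R).symm) <| and_congr (hσ _ _ _ _) <| and_congr (hσ _ _ _ _) <|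
    σ.forall_congr fun A => iff_congr (hT P R A).symm (hT P Q A).symm

end Adjacency

/-! ### Descent to lower dimension, down to points -/

section Descent

set_option linter.unusedSectionVars false

variable {F V : Type*} [Field F] [AddCommGroup V] [Module F V] [FiniteDimensional F V]
  {E : Submodule F V} {m : ℕ}

/-- The neighbours `A` of `Q` in the fibre of `P` are the members of that fibre through `P ⊓ Q`. If
`R` is adjacent to all of them, they all contain `P ⊓ R`; tilting gives `P ⊓ R ≤ P ⊓ Q`, and the
dimensions agree. -/
theorem Adj.inf_le_iff (hE : E ≠ ⊥) {P Q : Trans E m} (h : Adj P Q) (R : Trans E m) :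
    P.1 ⊓ Q.1 ≤ R.1 ↔ (Fib R P ∧ Adj R Q) ∨
      (¬ Fib R P ∧ ∀ A, Fib A P → Adj A Q → Adj R A) := by
  constructor
  · intro hR
    by_cases hRP : Fib R P
    · exact .inl ⟨hRP, h.of_color_eq (h.twin_iff.2 ⟨hRP, hR⟩).2⟩
    · refine .inr ⟨hRP, fun A hA hAQ => adj_of_le hR ?_ h.1 fun h' => hRP (h'.trans hA)⟩
      rw [← h.inf_eq_of_fib hA hAQ]
      exact inf_le_left
  · rintro (⟨hRP, hRQ⟩ | ⟨hRP, hA⟩)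
    · rw [← h.inf_eq_of_fib hRP hRQ]
      exact inf_le_left
    · have hPR := (hA P rfl h).symm
      have hle : P.1 ⊓ R.1 ≤ P.1 ⊓ Q.1 := by
        intro d hd
        by_contra hdW
        obtain ⟨A, hAP, hWA, hdA⟩ := exists_fib_notMem hE inf_le_left hd.1 hdW
        have hAQ := h.of_color_eq (h.twin_iff.2 ⟨hAP, hWA⟩).2
        have := hPR.inf_eq_of_fib hAP (hA A hAP hAQ).symm
        exact hdA (this.ge hd).1
      have h1 := h.1
      have h2 := hPR.1
      rw [← Submodule.eq_of_le_of_finrank_eq hle (by omega)]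
      exact inf_le_right

theorem exists_trans_ge (hn : m + finrank F E < finrank F V) (W : Trans E m) :
    ∃ P : Trans E (m + 1), W.1 ≤ P.1 := by
  obtain ⟨x, hx⟩ := exists_notMem_of_finrank_lt (W.2.finrank_sup.trans_lt hn)
  exact ⟨⟨_, W.2.sup_span hx⟩, le_sup_left⟩

theorem exists_adj_inf_eq_trans (hn : m + 1 + finrank F E < finrank F V) (W : Trans E m) :
    ∃ P Q : Trans E (m + 1), Adj P Q ∧ P.1 ⊓ Q.1 = W.1 := by
  obtain ⟨P, hP⟩ := exists_trans_ge (by omega) W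
  exact ⟨P, exists_adj_inf_eq hn hP (by rw [W.2.finrank_eq])⟩

theorem Trans.ext_of_le_iff (hn : m + 1 + finrank F E < finrank F V) {W U : Trans E m}
    (h : ∀ R : Trans E (m + 1), W.1 ≤ R.1 → U.1 ≤ R.1) : W = U := by
  obtain ⟨P, Q, -, hW⟩ := exists_adj_inf_eq_trans hn W
  refine (Subtype.ext (U.2.eq_of_le W.2 ?_)).symm
  rw [← hW]
  exact le_inf (h P (hW ▸ inf_le_left)) (h Q (hW ▸ inf_le_right))

theorem exists_le_iff_le_apply (hE : E ≠ ⊥) (hn : m + 1 + finrank F E < finrank F V)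
    (σ : Equiv.Perm (Trans E (m + 1))) (hF : ∀ P Q, Fib (σ P) (σ Q) ↔ Fib P Q)
    (hA : ∀ P Q, Adj (σ P) (σ Q) ↔ Adj P Q) (W : Trans E m) :
    ∃ U : Trans E m, ∀ R : Trans E (m + 1), W.1 ≤ R.1 ↔ U.1 ≤ (σ R).1 := by
  obtain ⟨P, Q, h, hW⟩ := exists_adj_inf_eq_trans hn W
  have h' := (hA P Q).2 h
  have hU := (σ P).2.mono (inf_le_left : (σ P).1 ⊓ (σ Q).1 ≤ (σ P).1)
  rw [Nat.add_right_cancel h'.1] at hU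
  refine ⟨⟨_, hU⟩, fun R => ?_⟩
  rw [← hW, h.inf_le_iff hE, h'.inf_le_iff hE, hF, hA]
  refine or_congr_right (and_congr_right fun _ => σ.forall_congr fun A => ?_)
  rw [hF, hA, hA]

theorem Adj.isTrans_sup {W U : Trans E m} (h : Adj W U) : IsTrans E (m + 1) (W.1 ⊔ U.1) := by
  obtain ⟨x, hx, hxW⟩ := SetLike.not_le_iff_exists.1 fun h' =>
    h.2 (U.2.sup_eq_of_le W.2 h').symm
  have h1 := W.2.sup_span hxW
  have h2 : W.1 ⊔ span F {x} = W.1 ⊔ U.1 := by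
    refine Submodule.eq_of_le_of_finrank_eq
      (sup_le_sup_left ((span_singleton_le_iff_mem _ _).2 hx) _) ?_
    have := finrank_sup_add_finrank_inf_eq W.1 U.1
    rw [W.2.finrank_eq, U.2.finrank_eq] at this
    have := h.1
    have := h1.finrank_eq
    omega
  rwa [← h2]

/-- Together with `fib_iff_forall_ge`, this reads the structure in dimension `m` off incidence with
dimension `m + 1`. Cofibral subspaces of one transversal `P` coincide, since `W = (W ⊔ E) ⊓ P`. -/
theorem adj_iff_exists_ge {W U : Trans E m} :
    Adj W U ↔ W ≠ U ∧ ∃ P : Trans E (m + 1), W.1 ≤ P.1 ∧ U.1 ≤ P.1 := by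
  constructor
  · intro h
    exact ⟨fun h' => h.2 (h' ▸ rfl), ⟨_, h.isTrans_sup⟩, le_sup_left, le_sup_right⟩
  · rintro ⟨hne, P, hW, hU⟩
    refine ⟨?_, fun h => hne (Subtype.ext ?_)⟩
    · have h1 := finrank_sup_add_finrank_inf_eq W.1 U.1
      rw [W.2.finrank_eq, U.2.finrank_eq] at h1
      have h2 := finrank_mono (sup_le hW hU)
      rw [P.2.finrank_eq] at h2
      have h3 : finrank F ↥(W.1 ⊓ U.1) < m := by
        refine lt_of_le_of_ne ((finrank_mono inf_le_left).trans W.2.finrank_eq.le) fun h => ?_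
        have h4 : W.1 ⊓ U.1 = W.1 :=
          Submodule.eq_of_le_of_finrank_eq inf_le_left (h.trans W.2.finrank_eq.symm)
        exact hne (Subtype.ext (W.2.eq_of_le U.2 (inf_eq_left.1 h4)))
      omega
    · rw [← sup_inf_of_le hW, ← sup_inf_of_le hU, show W.1 ⊔ E = U.1 ⊔ E from h]

theorem fib_iff_forall_ge (hn : m + 1 + finrank F E < finrank F V) {W U : Trans E m} :
    Fib W U ↔ ∀ P : Trans E (m + 1), W.1 ≤ P.1 → ∃ Q : Trans E (m + 1), U.1 ≤ Q.1 ∧ Fib P Q := by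
  constructor
  · intro h P hP
    obtain ⟨x, hx, hxW⟩ := SetLike.not_le_iff_exists.1 fun h : P.1 ≤ W.1 => by
      have := finrank_mono h
      rw [P.2.finrank_eq, W.2.finrank_eq] at this
      omega
    have hxU : x ∉ U.1 ⊔ E := fun h' => hxW <| by
      rw [← sup_inf_of_le hP, show W.1 ⊔ E = U.1 ⊔ E from h]
      exact ⟨h', hx⟩
    refine ⟨⟨_, U.2.sup_span hxU⟩, le_sup_left, Eq.symm ?_⟩
    refine (U.2.sup_span hxU).sup_eq_of_le P.2 (sup_le ?_ ?_)
    · exact le_sup_left.trans (h.ge.trans (sup_le_sup_right hP E))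
    · exact (span_singleton_le_iff_mem _ _).2 (mem_sup_left hx)
  · intro h
    obtain ⟨P, Q, hPQ, hW⟩ := exists_adj_inf_eq_trans hn W
    obtain ⟨A, hA, hPA⟩ := h P (hW ▸ inf_le_left)
    obtain ⟨B, hB, hQB⟩ := h Q (hW ▸ inf_le_right)
    refine (U.2.sup_eq_of_le W.2 ?_).symm
    rw [← hW, ← hPQ.inf_sup_eq, inf_sup_sup_eq]
    exact le_inf ((hA.trans le_sup_left).trans hPA.ge) ((hB.trans le_sup_left).trans hQB.ge)

/-- A permutation of the subspaces of dimension `m + 1` that preserves adjacency and equality of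
images modulo `E` induces such a permutation on the subspaces of dimension `m`. -/
theorem exists_descent (hE : E ≠ ⊥) (hn : m + 1 + finrank F E < finrank F V)
    (σ : Equiv.Perm (Trans E (m + 1))) (hF : ∀ P Q, Fib (σ P) (σ Q) ↔ Fib P Q)
    (hA : ∀ P Q, Adj (σ P) (σ Q) ↔ Adj P Q) :
    ∃ τ : Equiv.Perm (Trans E m), (∀ W U, Fib (τ W) (τ U) ↔ Fib W U) ∧
      (∀ W U, Adj (τ W) (τ U) ↔ Adj W U) ∧
      ∀ (W : Trans E m) (P : Trans E (m + 1)), W.1 ≤ P.1 ↔ (τ W).1 ≤ (σ P).1 := by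
  choose f hf using exists_le_iff_le_apply hE hn σ hF hA
  choose g hg using exists_le_iff_le_apply hE hn σ.symm
    (fun P Q => by rw [← hF]; simp) (fun P Q => by rw [← hA]; simp)
  let τ : Equiv.Perm (Trans E m) :=
    { toFun := f
      invFun := g
      left_inv := fun W => (Trans.ext_of_le_iff hn fun R hR => by
        have := (hg (f W) (σ R)).1 ((hf W R).1 hR)
        simpa using this).symm
      right_inv := fun W => (Trans.ext_of_le_iff hn fun R hR => by
        have := (hf (g W) (σ.symm R)).1 ((hg W R).1 hR)
        simpa using this).symm }
  have hτ : ∀ (W : Trans E m) (P : Trans E (m + 1)), W.1 ≤ P.1 ↔ (τ W).1 ≤ (σ P).1 := hf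
  refine ⟨τ, fun W U => ?_, fun W U => ?_, hτ⟩
  · rw [fib_iff_forall_ge hn, fib_iff_forall_ge hn]
    refine (σ.forall_congr fun P => imp_congr (hτ W P) (σ.exists_congr fun Q => ?_)).symm
    rw [hτ, hF]
  · rw [adj_iff_exists_ge, adj_iff_exists_ge]
    refine (and_congr τ.injective.ne_iff.symm (σ.exists_congr fun P => ?_)).symm
    exact and_congr (hτ W P) (hτ U P)

theorem adj_of_not_fib_one {p q : Trans E 1} (h : ¬ Fib p q) : Adj p q :=
  adj_of_le bot_le bot_le (by simp) h

/-- The induction starts at dimension 2 because the permutation of transversal lines is what makes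
the point permutation preserve collinearity. -/
theorem exists_point_perm (hE : E ≠ ⊥) (k : ℕ) (hn : k + 2 + finrank F E < finrank F V)
    (σ : Equiv.Perm (Trans E (k + 2))) (hF : ∀ P Q, Fib (σ P) (σ Q) ↔ Fib P Q)
    (hA : ∀ P Q, Adj (σ P) (σ Q) ↔ Adj P Q) :
    ∃ τ : Equiv.Perm (Trans E 1), (∀ p q, Fib (τ p) (τ q) ↔ Fib p q) ∧
      (∀ p q r, ¬ Fib p q → (r.1 ≤ p.1 ⊔ q.1 ↔ (τ r).1 ≤ (τ p).1 ⊔ (τ q).1)) ∧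
      ∀ (p : Trans E 1) (P : Trans E (k + 2)), p.1 ≤ P.1 ↔ (τ p).1 ≤ (σ P).1 := by
  induction k with
  | zero =>
    obtain ⟨τ, h1, h2, h3⟩ := exists_descent hE hn σ hF hA
    refine ⟨τ, h1, fun p q r hpq => ?_, h3⟩
    have h4 := adj_of_not_fib_one hpq
    have h5 := (h2 p q).2 h4
    have h6 : (σ ⟨_, h4.isTrans_sup⟩).1 = (τ p).1 ⊔ (τ q).1 :=
      (h5.isTrans_sup.eq_of_le (σ ⟨_, h4.isTrans_sup⟩).2
        (sup_le ((h3 _ _).1 le_sup_left) ((h3 _ _).1 le_sup_right))).symm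
    rw [← h6, ← h3]
  | succ k ih =>
    obtain ⟨ρ, h1, h2, h3⟩ := exists_descent hE hn σ hF hA
    obtain ⟨τ, h4, h5, h6⟩ := ih (by omega) ρ h1 h2
    refine ⟨τ, h4, h5, ?_⟩
    have key : ∀ (p : Trans E 1) (P : Trans E (k + 2 + 1)), p.1 ≤ P.1 ↔
        ∃ W : Trans E (k + 2), p.1 ≤ W.1 ∧ W.1 ≤ P.1 := by
      refine fun p P => ⟨fun h => ?_, fun ⟨W, h, h'⟩ => h.trans h'⟩
      obtain ⟨x, hx, hxp⟩ := SetLike.not_le_iff_exists.1 fun h : P.1 ≤ p.1 => by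
        have := finrank_mono h
        rw [P.2.finrank_eq, p.2.finrank_eq] at this
        omega
      obtain ⟨H, h1, h2, h3, h4⟩ := exists_hyperplane h hx hxp
      have h5 := P.2.mono h2
      rw [Nat.add_right_cancel (finrank_hyperplane P.2.finrank_eq h3 h4)] at h5
      exact ⟨⟨H, h5⟩, h1, h2⟩
    intro p P
    rw [key, key]
    refine ρ.exists_congr fun W => ?_
    rw [h6, h3]

end Descent

/-! ### The fundamental theorem of projective geometry away from `E` -/

section FundamentalTheorem

variable {F V : Type*} [Field F] [AddCommGroup V] [Module F V]

/-- Linear independence of two vectors modulo `E`. -/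
def IndepPair (E : Submodule F V) (v w : V) : Prop :=
  ∀ a b : F, a • v + b • w ∈ E → a = 0 ∧ b = 0

/-- Linear independence of three vectors modulo `E`. -/
def IndepTriple (E : Submodule F V) (u v w : V) : Prop :=
  ∀ a b c : F, a • u + b • v + c • w ∈ E → a = 0 ∧ b = 0 ∧ c = 0

/-- A relation between vectors outside `E` that comes from a collineation of the projective space
with `E` removed. -/
structure Collineation (E : Submodule F V) (M : V → V → Prop) : Prop where
  notMem_left : ∀ {v y}, M v y → v ∉ E
  notMem_right : ∀ {v y}, M v y → y ∉ E
  exists_right : ∀ {v}, v ∉ E → ∃ y, M v y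
  smul_left : ∀ {v y} {c : F}, c ≠ 0 → M v y → M (c • v) y
  smul_right : ∀ {v y} {c : F}, c ≠ 0 → M v y → M v (c • y)
  unique : ∀ {v y z}, M v y → M v z → ∃ c : F, z = c • y
  inj : ∀ {v w y}, M v y → M w y → ∃ c : F, w = c • v
  fib : ∀ {v w y z}, M v y → M w z → w - v ∈ E → ∃ c : F, z - c • y ∈ E
  pair : ∀ {v w y z}, M v y → M w z → IndepPair E v w → IndepPair E y z
  triple : ∀ {u v w x y z}, M u x → M v y → M w z → IndepTriple E u v w → IndepTriple E x y z
  line : ∀ {v w y z s} {a b : F}, M v y → M w z → IndepPair E v w → M (a • v + b • w) s →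
    ∃ c d : F, s = c • y + d • z

variable {E : Submodule F V} {M : V → V → Prop}

theorem eq_zero_of_smul_mem {A : Submodule F V} {c : F} {x : V} (hx : x ∉ A) (h : c • x ∈ A) :
    c = 0 := by
  by_contra hc
  exact hx (by simpa [smul_smul, hc] using A.smul_mem c⁻¹ h)

theorem indepPair_of_notMem {v w : V} (hv : v ∉ E) (hw : w ∉ E ⊔ span F {v}) :
    IndepPair E v w := by
  intro a b h
  have hb : b = 0 := eq_zero_of_smul_mem hw <| by
    have := sub_mem (mem_sup_left h : _ ∈ E ⊔ span F {v})
      (mem_sup_right (smul_mem _ a (mem_span_singleton_self v)))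
    simpa using this
  subst hb
  exact ⟨eq_zero_of_smul_mem hv (by simpa using h), rfl⟩

theorem indepTriple_of_notMem {u v w : V} (h : IndepPair E u v)
    (hw : w ∉ E ⊔ span F {u} ⊔ span F {v}) : IndepTriple E u v w := by
  intro a b c h'
  have hc : c = 0 := eq_zero_of_smul_mem hw <| by
    have := sub_mem (sub_mem (mem_sup_left (mem_sup_left h') : _ ∈ E ⊔ span F {u} ⊔ span F {v})
      (mem_sup_left (mem_sup_right (smul_mem _ a (mem_span_singleton_self u)))))
      (mem_sup_right (smul_mem _ b (mem_span_singleton_self v)))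
    convert this using 1
    module
  subst hc
  obtain ⟨h1, h2⟩ := h a b (by simpa using h')
  exact ⟨h1, h2, rfl⟩

theorem IndepPair.notMem_left {v w : V} (h : IndepPair E v w) : v ∉ E := fun hv => by
  have := h 1 0 (by simpa using hv)
  simp at this

theorem IndepPair.notMem_right {v w : V} (h : IndepPair E v w) : w ∉ E := fun hv => by
  have := h 0 1 (by simpa using hv)
  simp at this

theorem IndepPair.add_notMem {v w : V} (h : IndepPair E v w) : v + w ∉ E := fun hv => by
  have := h 1 1 (by simpa using hv)
  simp at this

namespace Collineation

/-- Once `v₀ ↦ y₀` is fixed, the image of `v₀ + x` normalises the scalar in the image of `x`. Both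
coefficients on the image line are nonzero because `v₀ + x` is independent of `v₀` and of `x` modulo
`E`. -/
theorem exists_lift (h : Collineation E M) {v₀ y₀ : V} (h₀ : M v₀ y₀) {x : V}
    (hx : IndepPair E v₀ x) : ∃ g, M x g ∧ M (v₀ + x) (y₀ + g) := by
  obtain ⟨z, hz⟩ := h.exists_right hx.notMem_right
  obtain ⟨s, hs⟩ := h.exists_right hx.add_notMem
  obtain ⟨a, b, rfl⟩ := h.line (a := 1) (b := 1) (s := s) h₀ hz hx (by simpa using hs)
  have ha : a ≠ 0 := by
    rintro rfl
    have h1 : IndepPair E x (v₀ + x) := fun c d hcd => by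
      have := hx d (c + d) (by convert hcd using 1; module)
      grind
    have := h.pair hz hs h1 b (-1) (by
      convert E.zero_mem using 1
      module)
    simp at this
  have hb : b ≠ 0 := by
    rintro rfl
    have h1 : IndepPair E v₀ (v₀ + x) := fun c d hcd => by
      have := hx (c + d) d (by convert hcd using 1; module)
      grind
    have := h.pair h₀ hs h1 a (-1) (by
      convert E.zero_mem using 1
      module)
    simp at this
  refine ⟨(a⁻¹ * b) • z, h.smul_right (mul_ne_zero (inv_ne_zero ha) hb) hz, ?_⟩
  convert h.smul_right (inv_ne_zero ha) hs using 1
  simp [smul_smul, ha]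

theorem lift_unique (h : Collineation E M) {v₀ y₀ : V} (h₀ : M v₀ y₀) {x g g' : V}
    (hx : IndepPair E v₀ x) (hg : M x g) (hg0 : M (v₀ + x) (y₀ + g)) (hg' : M x g')
    (hg0' : M (v₀ + x) (y₀ + g')) : g' = g := by
  obtain ⟨c, rfl⟩ := h.unique hg hg'
  obtain ⟨d, hd⟩ := h.unique hg0 hg0'
  have h1 := h.pair h₀ hg hx (1 - d) (c - d) (by
    convert E.zero_mem using 1
    rw [← sub_eq_zero] at hd
    rw [← hd]
    module)
  have : c = 1 := by grind
  simp [this]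

/-- The point of `v₀ + x + y` is where the line of `v₀ + x`, `y` meets that of `x`, `v₀ + y`, so it
maps to `y₀ + g + k`. Then `x + y`, on the line of `x`, `y` and that of `v₀`, `v₀ + x + y`, maps to
`g + k`. -/
theorem lift_add (h : Collineation E M) {v₀ y₀ : V} (h₀ : M v₀ y₀) {x y g k s : V}
    (hx : IndepTriple E v₀ x y) (hg : M x g) (hg0 : M (v₀ + x) (y₀ + g)) (hk : M y k)
    (hk0 : M (v₀ + y) (y₀ + k)) (hs : M (x + y) s) (hs0 : M (v₀ + (x + y)) (y₀ + s)) :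
    s = g + k := by
  have h3 := h.triple h₀ hg hk hx
  have hxy : IndepPair E v₀ (x + y) := fun a b hab => by
    have := hx a b b (by convert hab using 1; module)
    grind
  have hsum : M (v₀ + (x + y)) (y₀ + (g + k)) := by
    obtain ⟨r, hr⟩ := h.exists_right hxy.add_notMem
    obtain ⟨a, b, hab⟩ := h.line (a := 1) (b := 1) (s := r) hg0 hk (fun a b hab => by
      have := hx a a b (by convert hab using 1; module)
      grind) (by convert hr using 1; module)
    obtain ⟨c, d, hcd⟩ := h.line (a := 1) (b := 1) (s := r) hg hk0 (fun a b hab => by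
      have := hx b a b (by convert hab using 1; module)
      grind) (by convert hr using 1; module)
    have h4 := h3 (a - d) (a - c) (b - d) (by
      convert E.zero_mem using 1
      rw [← sub_eq_zero.2 (hab.symm.trans hcd)]
      module)
    have hr' : r = a • (y₀ + (g + k)) := by
      rw [hab, show b = a by grind]
      module
    have ha : a ≠ 0 := by
      rintro rfl
      exact h.notMem_right hr (by simp [hr'])
    convert h.smul_right (inv_ne_zero ha) hr using 1
    simp [hr', smul_smul, ha]
  have hadd : M (x + y) (g + k) := by
    obtain ⟨a, b, hab⟩ := h.line (a := 1) (b := 1) (s := s) hg hk (fun a b hab => by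
      have := hx 0 a b (by convert hab using 1; module)
      grind) (by convert hs using 1; module)
    obtain ⟨c, d, hcd⟩ := h.line (a := -1) (b := 1) (s := s) h₀ hsum (fun a b hab => by
      have := hx (a + b) b b (by convert hab using 1; module)
      grind) (by convert hs using 1; module)
    have h4 := h3 (c + d) (d - a) (d - b) (by
      convert E.zero_mem using 1
      rw [← sub_eq_zero.2 (hcd.symm.trans hab)]
      module)
    have hr' : s = a • (g + k) := by
      rw [hab, show b = a by grind]
      module
    have ha : a ≠ 0 := by
      rintro rfl
      exact h.notMem_right hs (by simp [hr'])
    convert h.smul_right (inv_ne_zero ha) hs using 1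
    simp [hr', smul_smul, ha]
  exact h.lift_unique h₀ hxy hadd hsum hs hs0

variable [FiniteDimensional F V]

theorem exists_notMem_sup_span (hn : finrank F E + 3 < finrank F V) (u v w : V) :
    ∃ z, z ∉ E ⊔ span F {u} ⊔ span F {v} ⊔ span F {w} := by
  apply exists_notMem_of_finrank_lt
  have h1 : ∀ (A : Submodule F V) (x : V), finrank F ↥(A ⊔ span F {x}) ≤ finrank F A + 1 :=
    fun A x => (finrank_add_le_finrank_add_finrank _ _).trans
      (Nat.add_le_add_left (by simpa using finrank_span_le_card (R := F) ({x} : Set V)) _)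
  have := h1 (E ⊔ span F {u} ⊔ span F {v}) w
  have := h1 (E ⊔ span F {u}) v
  have := h1 E u
  omega

/-- A collineation is induced by an additive map. -/
theorem exists_addMonoidHom (h : Collineation E M) (hn : finrank F E + 3 < finrank F V) :
    ∃ G : V →+ V, (∀ x ∉ E, M x (G x)) ∧ ∀ x ∈ E, G x ∈ E := by
  obtain ⟨v₀, hv₀⟩ : ∃ v, v ∉ E := exists_notMem_of_finrank_lt (by omega)
  obtain ⟨y₀, h₀⟩ := h.exists_right hv₀
  have hlift : ∀ x, ∃ g, IndepPair E v₀ x → M x g ∧ M (v₀ + x) (y₀ + g) := fun x => by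
    by_cases hx : IndepPair E v₀ x
    · obtain ⟨g, hg⟩ := h.exists_lift h₀ hx
      exact ⟨g, fun _ => hg⟩
    · exact ⟨0, fun h => absurd h hx⟩
  choose g hg using hlift
  obtain ⟨W, hW⟩ : ∃ W, E ⊔ span F {v₀} = W := ⟨_, rfl⟩
  have hpair : ∀ {x}, x ∉ W → IndepPair E v₀ x := fun hx => indepPair_of_notMem hv₀ (hW ▸ hx)
  have htriple : ∀ {x y}, x ∉ W → y ∉ W ⊔ span F {x} → IndepTriple E v₀ x y :=
    fun hx hy => indepTriple_of_notMem (hpair hx) (hW ▸ hy)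
  have hadd : ∀ {x y}, x ∉ W → y ∉ W ⊔ span F {x} → g (x + y) = g x + g y := fun {x y} hx hy => by
    have h3 := htriple hx hy
    have hxy : IndepPair E v₀ (x + y) := fun a b hab => by
      have := h3 a b b (by convert hab using 1; module)
      grind
    have hy' : IndepPair E v₀ y := hpair fun h => hy (mem_sup_left h)
    exact h.lift_add h₀ h3 (hg x (hpair hx)).1 (hg x (hpair hx)).2 (hg y hy').1 (hg y hy').2
      (hg _ hxy).1 (hg _ hxy).2
  have hself : ∀ x : V, x ∈ span F {x} := fun x => mem_span_singleton_self x
  have hz₁ : ∀ {x z}, z ∉ W ⊔ span F {x} → z ∉ W := fun hz h => hz (mem_sup_left h)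
  have hz₂ : ∀ {x z}, z ∉ W ⊔ span F {x} → x + z ∉ W := fun {x z} hz h => hz <| by
    simpa using sub_mem (mem_sup_left h : _ ∈ W ⊔ span F {x}) (mem_sup_right (hself x))
  have hstep : ∀ {x z z'}, z ∉ W ⊔ span F {x} → z' ∉ W ⊔ span F {x} ⊔ span F {z} →
      g (x + z) - g z = g (x + z') - g z' := by
    intro x z z' hz hz'
    have h1 : g (x + z + z') = g (x + z) + g z' := by
      refine hadd (hz₂ hz) fun h' => hz' ?_
      refine SetLike.le_def.1 (sup_le (le_sup_left.trans le_sup_left) ?_) h'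
      exact (span_singleton_le_iff_mem _ _).2
        (add_mem (mem_sup_left (mem_sup_right (hself x))) (mem_sup_right (hself z)))
    have h2 : g (z + (x + z')) = g z + g (x + z') := by
      refine hadd (hz₁ hz) fun h' => hz' ?_
      have := sub_mem (sup_le_sup_right (le_sup_left : W ≤ W ⊔ span F {x}) _ h')
        (mem_sup_left (mem_sup_right (hself x)) : x ∈ W ⊔ span F {x} ⊔ span F {z})
      simpa using this
    have h3 : x + z + z' = z + (x + z') := by abel
    rw [h3, h2] at h1
    rw [sub_eq_sub_iff_add_eq_add, ← h1, add_comm]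
  have hexists : ∀ x y, ∃ z, z ∉ W ⊔ span F {x} ⊔ span F {y} := fun x y =>
    hW ▸ exists_notMem_sup_span hn v₀ x y
  -- The partial map `g` extends to `G x = g (x + z) - g z` for generic `z`. Two choices of `z` are
  -- compared by expanding `g (x + z + z')` in two ways, through a third vector if they are not
  -- independent enough; this is where the codimension of `E` has to exceed 3.
  have hwd : ∀ x, ∃ y, ∀ z ∉ W ⊔ span F {x}, g (x + z) - g z = y := by
    intro x
    obtain ⟨z, hz⟩ := hexists x x
    replace hz : z ∉ W ⊔ span F {x} := fun h => hz (mem_sup_left h)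
    refine ⟨g (x + z) - g z, fun z' hz' => ?_⟩
    by_cases h1 : z' ∈ W ⊔ span F {x} ⊔ span F {z}
    · obtain ⟨t, ht⟩ := hexists x z
      rw [hstep hz ht]
      refine hstep hz' fun h' => ht (SetLike.le_def.1 (sup_le le_sup_left ?_) h')
      exact (span_singleton_le_iff_mem _ _).2 h1
    · exact (hstep hz h1).symm
  choose G hG using hwd
  have hGadd : ∀ x y, G (x + y) = G x + G y := by
    intro x y
    obtain ⟨z, hz⟩ := hexists x y
    have h1 : z ∉ W ⊔ span F {x + y} := fun h' => hz <| by
      refine SetLike.le_def.1 (sup_le (le_sup_left.trans le_sup_left) ?_) h'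
      exact (span_singleton_le_iff_mem _ _).2
        (add_mem (mem_sup_left (mem_sup_right (hself x))) (mem_sup_right (hself y)))
    have h2 : z ∉ W ⊔ span F {y} := fun h' => hz (SetLike.le_def.1 (sup_le_sup_right le_sup_left _) h')
    have h3 : y + z ∉ W ⊔ span F {x} := fun h' => hz <| by
      simpa using sub_mem (mem_sup_left h') (mem_sup_right (hself y) :
        y ∈ W ⊔ span F {x} ⊔ span F {y})
    rw [← hG _ _ h1, ← hG _ _ h2, ← hG _ _ h3, add_assoc]
    abel
  refine ⟨⟨⟨G, by simpa using hGadd 0 0⟩, hGadd⟩, fun x hx => ?_, fun x hx => ?_⟩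
  · change M x (G x)
    obtain ⟨r, hr⟩ := h.exists_right hx
    obtain ⟨z, hz⟩ := hexists x x
    replace hz : z ∉ W ⊔ span F {x} := fun h => hz (mem_sup_left h)
    obtain ⟨z', hz'⟩ := hexists x z
    have hz'x : z' ∉ W ⊔ span F {x} := fun h => hz' (mem_sup_left h)
    have hEW : E ≤ W := hW ▸ le_sup_left
    have hind : ∀ {t}, t ∉ W ⊔ span F {x} → IndepPair E (x + t) t := fun {t} ht a b hab => by
      have := indepPair_of_notMem hx (fun h' => ht (sup_le_sup_right hEW _ h')) a (a + b)
        (by convert hab using 1; module)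
      grind
    -- As `x` lies on the line of `x + t` and `t`, its image lies in the span of `G x` and `g t`.
    -- Two independent choices of `t` leave only multiples of `G x`.
    have hr₁ : ∀ {t}, t ∉ W ⊔ span F {x} → ∃ a b : F, r = a • G x + b • g t := fun {t} ht => by
      obtain ⟨a, b, hab⟩ := h.line (a := 1) (b := -1) (s := r) (hg _ (hpair (hz₂ ht))).1
        (hg _ (hpair (hz₁ ht))).1 (hind ht) (by convert hr using 1; module)
      refine ⟨a, a + b, ?_⟩
      rw [hab, ← hG x t ht]
      module
    obtain ⟨a, b, hab⟩ := hr₁ hz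
    obtain ⟨c, d, hcd⟩ := hr₁ hz'x
    have h3 : IndepTriple E (x + z) z z' := indepTriple_of_notMem (hind hz) fun h' => hz' <| by
      refine sup_le (sup_le (hEW.trans (le_sup_left.trans le_sup_left)) ?_) le_sup_right h'
      exact (span_singleton_le_iff_mem _ _).2
        (add_mem (mem_sup_left (mem_sup_right (hself x))) (mem_sup_right (hself z)))
    have h4 := h.triple (hg _ (hpair (hz₂ hz))).1 (hg _ (hpair (hz₁ hz))).1
      (hg _ (hpair (hz₁ hz'x))).1 h3 (a - c) (c - a + b) (-d) (by
        convert E.zero_mem using 1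
        rw [← sub_eq_zero.2 (hab.symm.trans hcd), ← hG x z hz]
        module)
    have hb : b = 0 := by grind
    subst hb
    rw [zero_smul, add_zero] at hab
    have ha : a ≠ 0 := by
      rintro rfl
      exact h.notMem_right hr (by simp [hab])
    convert h.smul_right (inv_ne_zero ha) hr using 1
    simp [hab, smul_smul, ha]
  · change G x ∈ E
    obtain ⟨z, hz⟩ := hexists x x
    replace hz : z ∉ W ⊔ span F {x} := fun h => hz (mem_sup_left h)
    have h1 := hg _ (hpair (hz₁ hz))
    have h2 := hg _ (hpair (hz₂ hz))
    -- Adding `x ∈ E` keeps the fibres of both `z` and `v₀ + z`; subtracting the two resulting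
    -- relations forces both scalars to be 1.
    obtain ⟨c, hc⟩ := h.fib h1.1 h2.1 (by simpa using hx)
    obtain ⟨d, hd⟩ := h.fib h1.2 h2.2 (by simpa using hx)
    have h3 := h.pair h₀ h1.1 (hpair (hz₁ hz)) (1 - d) (c - d) (by
      convert sub_mem hd hc using 1
      module)
    have hc1 : c = 1 := by grind
    subst hc1
    rw [← hG x z hz]
    simpa using hc

/-- A collineation of a finite projective space with `E` removed is induced by a semilinear
bijection that fixes `E`. -/
theorem exists_gammaL [Finite F] (h : Collineation E M) (hn : finrank F E + 3 < finrank F V) :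
    ∃ g : GammaL F V, (∀ x ∉ E, M x ((g : Equiv.Perm V) x)) ∧ g • E = E := by
  obtain ⟨G, hM, hGE⟩ := h.exists_addMonoidHom hn
  have hex : ∀ x : V, ∀ y : V, ∃ z, z ∉ E ⊔ span F {x} ⊔ span F {y} := fun x y => by
    obtain ⟨z, hz⟩ := exists_notMem_sup_span hn x y y
    exact ⟨z, fun h => hz (mem_sup_left h)⟩
  obtain ⟨v₀, hv₀⟩ : ∃ v, v ∉ E := exists_notMem_of_finrank_lt (by omega)
  have hs : ∀ x ∉ E, ∀ c : F, ∃ s : F, G (c • x) = s • G x := fun x hx c => by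
    obtain rfl | hc := eq_or_ne c 0
    · exact ⟨0, by simp⟩
    · have h1 := h.smul_left hc (hM x hx)
      exact h.unique h1 (hM _ (h.notMem_left h1))
  -- Independent vectors have the same multiplier, by comparison with that of their sum; a generic
  -- third vector then links any two vectors outside `E`.
  have heq : ∀ {x y : V} {c s : F}, IndepPair E x y → G (c • x) = s • G x →
      G (c • y) = s • G y := fun {x y c s} hxy hx => by
    obtain ⟨s', hs'⟩ := hs y hxy.notMem_right c
    obtain ⟨t, ht⟩ := hs (x + y) hxy.add_notMem c
    rw [smul_add, map_add, map_add, hx, hs'] at ht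
    have := h.pair (hM x hxy.notMem_left) (hM y hxy.notMem_right) hxy (s - t) (s' - t) (by
      convert E.zero_mem using 1
      rw [← sub_eq_zero.2 ht]
      module)
    rw [hs', show s' = s by grind]
  choose S hS using hs v₀ hv₀
  have hSx : ∀ (c : F) (x : V), G (c • x) = S c • G x := by
    have h1 : ∀ x ∉ E, ∀ c : F, G (c • x) = S c • G x := fun x hx c => by
      obtain ⟨z, hz⟩ := hex v₀ x
      have hz1 : IndepPair E v₀ z := indepPair_of_notMem hv₀ fun h => hz (mem_sup_left h)
      have hz2 : IndepPair E x z := indepPair_of_notMem hx fun h =>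
        hz (SetLike.le_def.1 (sup_le_sup_right le_sup_left _) h)
      refine heq (fun a b hab => ?_) (heq hz1 (hS c))
      exact (hz2 b a (by rwa [add_comm])).symm
    intro c x
    by_cases hx : x ∈ E
    · have h2 : x + v₀ ∉ E := fun h => hv₀ (by simpa using sub_mem h hx)
      have h3 := h1 _ h2 c
      rw [smul_add, map_add, map_add, h1 v₀ hv₀, smul_add] at h3
      exact add_right_cancel h3
    · exact h1 x hx c
  have hG₀ : G v₀ ≠ 0 := fun h' => h.notMem_right (hM v₀ hv₀) (h' ▸ E.zero_mem)
  have hcancel : ∀ a b : F, a • G v₀ = b • G v₀ → a = b := fun a b hab =>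
    smul_left_injective F hG₀ hab
  let f : F →+* F :=
    { toFun := S
      map_one' := hcancel _ _ (by rw [← hSx, one_smul, one_smul])
      map_mul' := fun a b => hcancel _ _ (by rw [← hSx, mul_smul, hSx, hSx, mul_smul])
      map_zero' := hcancel _ _ (by rw [← hSx, zero_smul, zero_smul, map_zero])
      map_add' := fun a b => hcancel _ _ (by rw [← hSx, add_smul, map_add, hSx, hSx, add_smul]) }
  -- Finiteness of `F` turns the field endomorphism into an automorphism, and later the injective
  -- `G` into a bijection.
  have hf : Function.Bijective f := Finite.injective_iff_bijective.1 f.injective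
  have : Finite V := Module.finite_of_finite F
  have hGinj : Function.Injective G := by
    rw [injective_iff_map_eq_zero]
    intro x hx
    by_cases hxE : x ∈ E
    · have h2 : x + v₀ ∉ E := fun h => hv₀ (by simpa using sub_mem h hxE)
      have h3 := hM _ h2
      rw [map_add, hx, zero_add] at h3
      obtain ⟨c, hc⟩ := h.inj (hM v₀ hv₀) h3
      have h4 : x = (c - 1) • v₀ := by
        rw [sub_smul, one_smul, ← hc, add_sub_cancel_right]
      have h5 : c - 1 = 0 := eq_zero_of_smul_mem hv₀ (by rwa [← h4])
      rw [h4, h5, zero_smul]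
    · exact absurd (hx ▸ E.zero_mem) (h.notMem_right (hM x hxE))
  have hGbij : Function.Bijective G := Finite.injective_iff_bijective.1 hGinj
  let g : GammaL F V := ⟨Equiv.ofBijective G hGbij, fun u v => map_add G u v,
    RingEquiv.ofBijective f hf, fun c v => hSx c v⟩
  refine ⟨g, fun x hx => hM x hx, ?_⟩
  have hle : g • E ≤ E := by
    rintro _ ⟨x, hx, rfl⟩
    exact hGE x hx
  exact Submodule.eq_of_le_of_finrank_eq hle
    (finrank_smul (QuotientGroup.mk g : GammaL F V ⧸ scalars F V) E)

end Collineation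

end FundamentalTheorem

/-! ### From point permutations to semilinear maps; faithfulness -/

section PointPerm

set_option linter.unusedSectionVars false

variable {F V : Type*} [Field F] [AddCommGroup V] [Module F V] [FiniteDimensional F V]
  {E : Submodule F V}

/-- The point spanned by a vector outside `E`. -/
def pt (v : V) (hv : v ∉ E) : Trans E 1 :=
  ⟨span F {v}, finrank_span_singleton fun h => hv (h ▸ E.zero_mem), by
    have := sup_span_inf_eq (H := ⊥) (A := E) (x := v) (by simpa using hv)
    simpa using this⟩

theorem exists_eq_pt (p : Trans E 1) : ∃ (v : V) (hv : v ∉ E), p = pt v hv := by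
  have : p.1 ≠ ⊥ := fun h => by
    have := p.2.finrank_eq
    rw [h, finrank_bot] at this
    omega
  obtain ⟨v, hv, hv0⟩ := exists_mem_ne_zero_of_ne_bot this
  have hvE : v ∉ E := fun h => hv0 (p.2.eq_zero hv h)
  exact ⟨v, hvE, (Subtype.ext ((pt v hvE).2.eq_of_le p.2
    ((span_singleton_le_iff_mem _ _).2 hv))).symm⟩

theorem pt_fib_iff {v w : V} (hv : v ∉ E) (hw : w ∉ E) :
    Fib (pt v hv) (pt w hw) ↔ ∃ c : F, w - c • v ∈ E := by
  constructor
  · intro h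
    have h1 : w ∈ span F {v} ⊔ E := by
      rw [show span F {v} ⊔ E = span F {w} ⊔ E from h]
      exact mem_sup_left (mem_span_singleton_self w)
    obtain ⟨y, hy, e, he, rfl⟩ := mem_sup.1 h1
    obtain ⟨c, rfl⟩ := mem_span_singleton.1 hy
    exact ⟨c, by simpa using he⟩
  · rintro ⟨c, hc⟩
    refine ((pt w hw).2.sup_eq_of_le (pt v hv).2 ((span_singleton_le_iff_mem _ _).2 ?_)).symm
    rw [← sub_add_cancel w (c • v)]
    exact add_mem (mem_sup_right hc)
      (mem_sup_left (smul_mem _ _ (mem_span_singleton_self v)))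

theorem indepPair_iff_not_fib {v w : V} (hv : v ∉ E) (hw : w ∉ E) :
    IndepPair E v w ↔ ¬ Fib (pt v hv) (pt w hw) := by
  rw [pt_fib_iff]
  constructor
  · rintro h ⟨c, hc⟩
    have := h (-c) 1 (by convert hc using 1; module)
    simp at this
  · intro h
    refine indepPair_of_notMem hv fun h' => h ?_
    obtain ⟨e, he, y, hy, rfl⟩ := mem_sup.1 h'
    obtain ⟨c, rfl⟩ := mem_span_singleton.1 hy
    exact ⟨c, by simpa using he⟩

theorem pt_smul {v : V} (hv : v ∉ E) {c : F} (hc : c ≠ 0) (hcv : c • v ∉ E) :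
    pt (c • v) hcv = pt v hv :=
  Subtype.ext (span_singleton_smul_eq hc.isUnit v)

theorem exists_smul_of_pt_eq {v w : V} {hv : v ∉ E} {hw : w ∉ E} (h : pt v hv = pt w hw) :
    ∃ c : F, w = c • v := by
  have h1 : w ∈ span F {v} := by
    rw [show span F {v} = span F {w} from congrArg Subtype.val h]
    exact mem_span_singleton_self w
  obtain ⟨c, hc⟩ := mem_span_singleton.1 h1
  exact ⟨c, hc.symm⟩

theorem collineation_of_perm (τ : Equiv.Perm (Trans E 1))
    (hF : ∀ p q, Fib (τ p) (τ q) ↔ Fib p q)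
    (hL : ∀ p q r, ¬ Fib p q → (r.1 ≤ p.1 ⊔ q.1 ↔ (τ r).1 ≤ (τ p).1 ⊔ (τ q).1)) :
    Collineation E fun v y => ∃ (hv : v ∉ E) (hy : y ∉ E), τ (pt v hv) = pt y hy := by
  have hpair : ∀ {v w y z : V}, (∃ (hv : v ∉ E) (hy : y ∉ E), τ (pt v hv) = pt y hy) →
      (∃ (hv : w ∉ E) (hy : z ∉ E), τ (pt w hv) = pt z hy) → IndepPair E v w →
      IndepPair E y z := by
    rintro v w y z ⟨hv, hy, h⟩ ⟨hw, hz, h'⟩ hvw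
    rw [indepPair_iff_not_fib hv hw] at hvw
    rwa [indepPair_iff_not_fib hy hz, ← h, ← h', hF]
  have hmem : ∀ {v w s : V}, s ∈ span F {v} ⊔ span F {w} → ∃ c d : F, s = c • v + d • w := by
    intro v w s hs
    obtain ⟨a, ha, b, hb, rfl⟩ := mem_sup.1 hs
    obtain ⟨c, rfl⟩ := mem_span_singleton.1 ha
    obtain ⟨d, rfl⟩ := mem_span_singleton.1 hb
    exact ⟨c, d, rfl⟩
  have hmem' : ∀ (v w : V) (a b : F), span F {a • v + b • w} ≤ span F {v} ⊔ span F {w} :=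
    fun v w a b => (span_singleton_le_iff_mem _ _).2
      (add_mem (mem_sup_left (smul_mem _ _ (mem_span_singleton_self v)))
        (mem_sup_right (smul_mem _ _ (mem_span_singleton_self w))))
  refine
    { notMem_left := fun ⟨hv, _⟩ => hv
      notMem_right := fun ⟨_, hy, _⟩ => hy
      exists_right := fun {v} hv => ?_
      smul_left := ?_
      smul_right := ?_
      unique := ?_
      inj := ?_
      fib := ?_
      pair := hpair
      triple := ?_
      line := ?_ }
  · obtain ⟨y, hy, h⟩ := exists_eq_pt (τ (pt v hv))
    exact ⟨y, hv, hy, h⟩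
  · rintro v y c hc ⟨hv, hy, h⟩
    have hcv : c • v ∉ E := fun h => hc (eq_zero_of_smul_mem hv h)
    exact ⟨hcv, hy, by rw [pt_smul hv hc, h]⟩
  · rintro v y c hc ⟨hv, hy, h⟩
    have hcv : c • y ∉ E := fun h => hc (eq_zero_of_smul_mem hy h)
    exact ⟨hv, hcv, by rw [pt_smul hy hc, h]⟩
  · rintro v y z ⟨hv, hy, h⟩ ⟨_, hz, h'⟩
    exact exists_smul_of_pt_eq (h.symm.trans h')
  · rintro v w y ⟨hv, hy, h⟩ ⟨hw, _, h'⟩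
    exact exists_smul_of_pt_eq (τ.injective (h.trans h'.symm))
  · rintro v w y z ⟨hv, hy, h⟩ ⟨hw, hz, h'⟩ hvw
    rw [← pt_fib_iff hy hz, ← h, ← h', hF, pt_fib_iff]
    exact ⟨1, by simpa using hvw⟩
  · rintro u v w x y z ⟨hu, hx, h⟩ ⟨hv, hy, h'⟩ ⟨hw, hz, h''⟩ h3
    have huv : IndepPair E u v := fun a b hab => by
      have := h3 a b 0 (by simpa using hab)
      exact ⟨this.1, this.2.1⟩
    -- If `z` were dependent, it would be cofibral with some `r` in the span of `x`, `y`. The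
    -- preimage of the point of `r` lies on the line of `u`, `v` and is cofibral with `w`, against
    -- independence.
    refine indepTriple_of_notMem (hpair ⟨hu, hx, h⟩ ⟨hv, hy, h'⟩ huv) fun hmz => ?_
    rw [sup_assoc] at hmz
    obtain ⟨e, he, r, hr, rfl⟩ := mem_sup.1 hmz
    have hrE : r ∉ E := fun h => hz (add_mem he h)
    obtain ⟨t, ht, hτ⟩ := exists_eq_pt (τ.symm (pt r hrE))
    rw [Equiv.symm_apply_eq] at hτ
    have h4 : (pt t ht).1 ≤ (pt u hu).1 ⊔ (pt v hv).1 := by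
      rw [hL _ _ _ ((indepPair_iff_not_fib hu hv).1 huv), ← hτ, h, h']
      exact (span_singleton_le_iff_mem _ _).2 hr
    obtain ⟨a, b, rfl⟩ := hmem (h4 (mem_span_singleton_self t))
    have h5 : Fib (pt r hrE) (pt _ hz) := (pt_fib_iff hrE hz).2 ⟨1, by simpa using he⟩
    rw [hτ, ← h'', hF, pt_fib_iff] at h5
    obtain ⟨c, hc⟩ := h5
    have := h3 (-(c * a)) (-(c * b)) 1 (by convert hc using 1; module)
    simp at this
  · rintro v w y z s a b ⟨hv, hy, h⟩ ⟨hw, hz, h'⟩ hvw ⟨ht, hs, h''⟩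
    have := (hL _ _ (pt _ ht) ((indepPair_iff_not_fib hv hw).1 hvw)).1 (hmem' v w a b)
    rw [h, h', h''] at this
    exact hmem (this (mem_span_singleton_self s))

/-- A permutation of the subspaces of dimension `m` that permutes the relations of the scheme is
induced by a semilinear bijection that fixes `E`. -/
theorem exists_gammaL_of_color [Finite F] (hE : E ≠ ⊥) {m : ℕ} (hm : 1 < m)
    (hn : m + 1 + finrank F E < finrank F V) (σ : Equiv.Perm (Trans E m))
    (hσ : ∀ P Q R S, color E P.1 Q.1 = color E R.1 S.1 ↔
      color E (σ P).1 (σ Q).1 = color E (σ R).1 (σ S).1) :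
    ∃ g : GammaL F V, g • E = E ∧ ∀ P, (σ P).1 = g • P.1 := by
  obtain ⟨k, rfl⟩ : ∃ k, m = k + 2 := ⟨m - 2, by omega⟩
  obtain ⟨hF, hA⟩ := fib_and_adj_apply_iff hE (by omega) (by omega) σ hσ
  obtain ⟨τ, h1, h2, h3⟩ := exists_point_perm hE k (by omega) σ hF hA
  obtain ⟨g, hg, hgE⟩ := (collineation_of_perm τ h1 h2).exists_gammaL (by omega)
  refine ⟨g, hgE, fun P => (Submodule.eq_of_le_of_finrank_eq ?_ ?_).symm⟩
  · rintro _ ⟨x, hx, rfl⟩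
    obtain rfl | hx0 := eq_or_ne x 0
    · have : (g : Equiv.Perm V) 0 = 0 := by simpa using g.2.1 0 0
      rw [this]
      exact zero_mem _
    · obtain ⟨hxE, hy, h⟩ := hg x fun h => hx0 (P.2.eq_zero hx h)
      have := (h3 (pt x hxE) P).1 ((span_singleton_le_iff_mem _ _).2 hx)
      rw [h] at this
      exact this (mem_span_singleton_self _)
  · rw [(σ P).2.finrank_eq]
    exact (finrank_smul (QuotientGroup.mk g : GammaL F V ⧸ scalars F V) P.1).trans P.2.finrank_eq

theorem exists_trans_mem_notMem {m : ℕ} (hm : 0 < m) (hn : m + finrank F E < finrank F V) {v u : V}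
    (hv : v ∉ E) (hu : u ∉ span F {v}) : ∃ P : Trans E m, v ∈ P.1 ∧ u ∉ P.1 := by
  induction m, hm using Nat.le_induction with
  | base => exact ⟨pt v hv, mem_span_singleton_self v, hu⟩
  | succ m _ ih =>
    obtain ⟨P, hvP, huP⟩ := ih (by omega)
    obtain ⟨x, hx⟩ : ∃ x, x ∉ P.1 ⊔ E ⊔ span F {u} := by
      refine exists_notMem_of_finrank_lt (lt_of_le_of_lt ?_ hn)
      refine (finrank_add_le_finrank_add_finrank _ _).trans ?_
      have := finrank_span_le_card (R := F) ({u} : Set V)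
      rw [Set.toFinset_singleton, Finset.card_singleton] at this
      rw [P.2.finrank_sup]
      omega
    refine ⟨⟨_, P.2.sup_span fun h => hx (mem_sup_left h)⟩, mem_sup_left hvP, fun h => huP ?_⟩
    have h1 : u ∈ (P.1 ⊔ span F {x}) ⊓ span F {u} := ⟨h, mem_span_singleton_self u⟩
    rw [sup_span_inf_eq fun h => hx (SetLike.le_def.1 (sup_le_sup_right le_sup_left _) h)] at h1
    exact h1.1

/-- The transversals through `v ∉ E` have only the multiples of `v` in common, so `v` is an
eigenvector. Independent vectors share the eigenvalue, and vectors of `E` are differences of vectors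
outside `E`. -/
theorem mem_scalars_of_smul_eq {m : ℕ} (hm : 0 < m) (hn : m + 1 + finrank F E < finrank F V)
    (g : GammaL F V) (hg : ∀ P : Trans E m, g • P.1 = P.1) : g ∈ scalars F V := by
  obtain ⟨f, hf⟩ : ∃ f : V → V, f = (g : Equiv.Perm V) := ⟨_, rfl⟩
  have hadd : ∀ u v, f (u + v) = f u + f v := hf ▸ g.2.1
  have h1 : ∀ v ∉ E, ∃ c : F, f v = c • v := by
    intro v hv
    by_contra h
    obtain ⟨P, hP, hP'⟩ := exists_trans_mem_notMem hm (by omega) hv (u := f v) fun h' => h <| by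
      obtain ⟨c, hc⟩ := mem_span_singleton.1 h'
      exact ⟨c, hc.symm⟩
    apply hP'
    rw [← hg P, hf]
    exact ⟨v, hP, rfl⟩
  have h2 : ∀ {v w : V} {c : F}, IndepPair E v w → f v = c • v → f w = c • w := by
    intro v w c hvw hc
    obtain ⟨d, hd⟩ := h1 w hvw.notMem_right
    obtain ⟨s, hs⟩ := h1 _ hvw.add_notMem
    rw [hadd, hc, hd] at hs
    have := hvw (c - s) (d - s) (by
      convert E.zero_mem using 1
      rw [← sub_eq_zero.2 hs]
      module)
    rw [hd, show d = c by grind]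
  obtain ⟨v₀, hv₀⟩ : ∃ v, v ∉ E := exists_notMem_of_finrank_lt (by omega)
  obtain ⟨c, hc⟩ := h1 v₀ hv₀
  have h3 : ∀ x ∉ E, f x = c • x := by
    intro x hx
    obtain ⟨z, hz⟩ : ∃ z, z ∉ E ⊔ span F {v₀} ⊔ span F {x} := by
      refine exists_notMem_of_finrank_lt (lt_of_le_of_lt ?_ hn)
      refine (finrank_add_le_finrank_add_finrank _ _).trans
        (Nat.add_le_add (finrank_add_le_finrank_add_finrank _ _) le_rfl |>.trans ?_)
      have h4 : ∀ u : V, finrank F (span F {u}) ≤ 1 := fun u => by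
        simpa using finrank_span_le_card (R := F) ({u} : Set V)
      have := h4 v₀
      have := h4 x
      omega
    have hz1 : IndepPair E v₀ z := indepPair_of_notMem hv₀ fun h => hz (mem_sup_left h)
    have hz2 : IndepPair E x z := indepPair_of_notMem hx fun h =>
      hz (SetLike.le_def.1 (sup_le_sup_right le_sup_left _) h)
    exact h2 (fun a b hab => (hz2 b a (by rwa [add_comm])).symm) (h2 hz1 hc)
  have h4 : ∀ x, f x = c • x := by
    intro x
    by_cases hx : x ∈ E
    · have h5 := h3 (x + v₀) fun h => hv₀ (by simpa using sub_mem h hx)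
      rw [hadd, hc, smul_add] at h5
      exact add_right_cancel h5
    · exact h3 x hx
  have hc0 : c ≠ 0 := by
    rintro rfl
    have h5 : f v₀ = f 0 := by rw [h4, h4, zero_smul, zero_smul]
    rw [hf] at h5
    exact hv₀ ((g : Equiv.Perm V).injective h5 ▸ E.zero_mem)
  exact ⟨Units.mk0 c hc0, fun v => by rw [← hf]; exact h4 v⟩

theorem gammaL_smul_sup (g : GammaL F V) (P Q : Submodule F V) : g • (P ⊔ Q) = g • P ⊔ g • Q := by
  apply le_antisymm
  · rintro _ ⟨x, hx, rfl⟩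
    obtain ⟨p, hp, q, hq, rfl⟩ := mem_sup.1 hx
    rw [g.2.1]
    exact add_mem (mem_sup_left ⟨p, hp, rfl⟩) (mem_sup_right ⟨q, hq, rfl⟩)
  · refine sup_le ?_ ?_
    · rintro _ ⟨x, hx, rfl⟩
      exact ⟨x, mem_sup_left hx, rfl⟩
    · rintro _ ⟨x, hx, rfl⟩
      exact ⟨x, mem_sup_right hx, rfl⟩

theorem color_smul (g : PGammaL F V) (hg : g • E = E) (P Q : Submodule F V) :
    color E (g • P) (g • Q) = color E P Q := by
  have h : g • Q ⊔ E = g • (Q ⊔ E) := by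
    obtain ⟨k, hk⟩ := exists_rep g
    rw [hk] at hg
    rw [hk, hk, gammaL_smul_sup, hg]
  rw [color, color, h, ← smul_inf, ← smul_inf, finrank_smul, finrank_smul]

end PointPerm

/-! ### Translation to the scheme -/

section Scheme

variable {F : Type*} [Field F] {n l m : ℕ}

theorem finrank_E : finrank F (E F n l) = l := by
  have h : LinearIndependent F fun i : Fin l =>
      (Pi.single (Fin.natAdd n i) (1 : F) : Fin (n + l) → F) := by
    have := (Pi.basisFun F (Fin (n + l))).linearIndependent.comp _ (Fin.natAdd_injective l n)
    simpa [Function.comp_def] using this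
  rw [E, finrank_span_eq_card h, Fintype.card_fin]

theorem ker_funLeft_castAdd :
    LinearMap.ker (LinearMap.funLeft F F (Fin.castAdd l : Fin n → Fin (n + l))) = E F n l := by
  have hle : E F n l ≤ LinearMap.ker (LinearMap.funLeft F F (Fin.castAdd l)) := by
    rw [E, span_le]
    rintro _ ⟨i, rfl⟩
    rw [SetLike.mem_coe, LinearMap.mem_ker]
    ext j
    rw [LinearMap.funLeft_apply, Pi.zero_apply]
    refine Pi.single_eq_of_ne (fun h => ?_) _
    have := congrArg Fin.val h
    simp only [Fin.val_castAdd, Fin.val_natAdd] at this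
    omega
  refine (Submodule.eq_of_le_of_finrank_eq hle ?_).symm
  have h1 := LinearMap.finrank_range_add_finrank_ker
    (LinearMap.funLeft F F (Fin.castAdd l : Fin n → Fin (n + l)))
  rw [LinearMap.range_eq_top.2 (LinearMap.funLeft_surjective_of_injective _ _ _
    (Fin.castAdd_injective n l)), finrank_top, finrank_fin_fun, finrank_fin_fun] at h1
  rw [finrank_E]
  omega

theorem isType_zero_iff (P : Submodule F (Fin (n + l) → F)) :
    IsType m 0 P ↔ IsTrans (E F n l) m P := by
  rw [IsType, Submodule.finrank_eq_zero]
  exact ⟨fun h => ⟨h.1, h.2⟩, fun h => ⟨h.1, h.2⟩⟩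

/-- The vertices of the scheme as transversal subspaces. -/
def vertexEquiv : Vertex F n l m ≃ Trans (E F n l) m := Equiv.subtypeEquivRight isType_zero_iff

theorem finrank_front {D : Submodule F (Fin (n + l) → F)} (hD : D ⊓ E F n l = ⊥) :
    finrank F (front D) = finrank F D := by
  rw [front, ← LinearMap.range_domRestrict]
  refine LinearMap.finrank_range_of_inj ?_
  rw [← LinearMap.ker_eq_bot, eq_bot_iff]
  rintro ⟨x, hx⟩ hxk
  have : x ∈ D ⊓ E F n l := ⟨hx, ker_funLeft_castAdd.le hxk⟩
  rw [hD, mem_bot] at this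
  simp [this]

/-- The projection has kernel `E`, so it is injective on `P`, and the preimage of `front Q` is `Q ⊔
E`. -/
theorem finrank_front_inf {P : Submodule F (Fin (n + l) → F)} (hP : P ⊓ E F n l = ⊥)
    (Q : Submodule F (Fin (n + l) → F)) :
    finrank F ↥(front P ⊓ front Q) = finrank F ↥(P ⊓ (Q ⊔ E F n l)) := by
  rw [← finrank_front (D := P ⊓ (Q ⊔ E F n l))
    (eq_bot_iff.2 ((inf_le_inf_right _ inf_le_left).trans hP.le))]
  rw [front, front, front, map_inf_eq_map_inf_comap, comap_map_eq, ker_funLeft_castAdd]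

theorem rel_iff_color {p : Index n l m} {P Q : Vertex F n l m} :
    rel F n l m p P Q ↔ (color (E F n l) P.1 Q.1).1 + p.1.1 = m ∧
      (color (E F n l) P.1 Q.1).2 + p.1.2 = m := by
  rw [rel, finrank_front_inf ((isType_zero_iff _).1 P.2).inf_eq]
  rfl

theorem rel_congr {p : Index n l m} {P Q R S : Vertex F n l m}
    (h : color (E F n l) P.1 Q.1 = color (E F n l) R.1 S.1) :
    rel F n l m p P Q ↔ rel F n l m p R S := by
  rw [rel_iff_color, rel_iff_color, h]

theorem color_eq_of_rel {p : Index n l m} {P Q R S : Vertex F n l m}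
    (h : rel F n l m p P Q) (h' : rel F n l m p R S) :
    color (E F n l) P.1 Q.1 = color (E F n l) R.1 S.1 := by
  rw [rel_iff_color] at h h'
  apply Prod.ext <;> omega

theorem exists_rel (P Q : Vertex F n l m) : ∃ p, rel F n l m p P Q := by
  have hP := (isType_zero_iff _).1 P.2
  have hQ := (isType_zero_iff _).1 Q.2
  have h1 := finrank_front_inf hP.inf_eq Q.1
  have h2 : finrank F ↥(P.1 ⊓ Q.1) ≤ finrank F ↥(P.1 ⊓ (Q.1 ⊔ E F n l)) :=
    finrank_mono (inf_le_inf_left _ le_sup_left)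
  have h3 : finrank F ↥(P.1 ⊓ (Q.1 ⊔ E F n l)) ≤ m :=
    (finrank_mono inf_le_left).trans hP.finrank_eq.le
  -- This gives `j - i ≤ l`; the bound `i ≤ n - m` comes from `h7`, a dimension count in `F ^ n`.
  have h4 : finrank F ↥(P.1 ⊓ (Q.1 ⊔ E F n l)) ≤ finrank F ↥(P.1 ⊓ Q.1) + l := by
    have h5 := finrank_sup_add_finrank_inf_eq (P.1 ⊓ (Q.1 ⊔ E F n l)) Q.1
    rw [inf_assoc, inf_eq_right.2 (le_sup_left : Q.1 ≤ Q.1 ⊔ E F n l), hQ.finrank_eq] at h5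
    have h6 : finrank F ↥(P.1 ⊓ (Q.1 ⊔ E F n l) ⊔ Q.1) ≤ m + l := by
      refine (finrank_mono (sup_le inf_le_right le_sup_left)).trans ?_
      rw [hQ.finrank_sup, finrank_E]
    omega
  have h7 : 2 * m ≤ n + finrank F ↥(P.1 ⊓ (Q.1 ⊔ E F n l)) := by
    have h8 := finrank_sup_add_finrank_inf_eq (front P.1) (front Q.1)
    rw [finrank_front hP.inf_eq, finrank_front hQ.inf_eq, hP.finrank_eq, hQ.finrank_eq, h1] at h8
    have h9 := (front P.1 ⊔ front Q.1).finrank_le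
    rw [finrank_fin_fun] at h9
    omega
  refine ⟨⟨(m - finrank F ↥(P.1 ⊓ (Q.1 ⊔ E F n l)), m - finrank F ↥(P.1 ⊓ Q.1)), ?_⟩, ?_⟩
  · dsimp only
    omega
  · exact rel_iff_color.2 ⟨Nat.add_sub_of_le h3, Nat.add_sub_of_le (h2.trans h3)⟩

/-- The indices may be permuted, so σ is not known to preserve colours themselves, only whether two
pairs have the same colour. -/
theorem color_eq_iff_of_mem_schemeAut {σ : Equiv.Perm (Vertex F n l m)}
    (hσ : σ ∈ schemeAut (rel F n l m)) (P Q R S : Vertex F n l m) :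
    color (E F n l) P.1 Q.1 = color (E F n l) R.1 S.1 ↔
      color (E F n l) (σ P).1 (σ Q).1 = color (E F n l) (σ R).1 (σ S).1 := by
  obtain ⟨π, hπ⟩ := hσ
  constructor
  · intro h
    obtain ⟨p, hp⟩ := exists_rel P Q
    exact color_eq_of_rel ((hπ _ _ _).1 hp) ((hπ _ _ _).1 ((rel_congr h).1 hp))
  · intro h
    obtain ⟨p, hp⟩ := exists_rel (σ P) (σ Q)
    obtain ⟨p, rfl⟩ := π.surjective p
    exact color_eq_of_rel ((hπ _ _ _).2 hp) ((hπ _ _ _).2 ((rel_congr h).1 hp))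

theorem injective_toPermHom (hm : 0 < m) (hmn : m + 1 < n) :
    Function.Injective (MulAction.toPermHom (PGammaLStab F n l) (Vertex F n l m)) := by
  rw [injective_iff_map_eq_one]
  rintro ⟨g, hg⟩ h
  obtain ⟨k, rfl⟩ := QuotientGroup.mk_surjective g
  refine Subtype.ext ((QuotientGroup.eq_one_iff k).2 ?_)
  refine mem_scalars_of_smul_eq (E := E F n l) hm ?_ k fun P => ?_
  · rw [finrank_E, finrank_fin_fun]
    omega
  · exact congrArg Subtype.val (DFunLike.congr_fun h (vertexEquiv.symm P))

theorem toPermHom_mem_schemeAut (g : PGammaLStab F n l) :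
    MulAction.toPermHom (PGammaLStab F n l) (Vertex F n l m) g ∈ schemeAut (rel F n l m) := by
  refine ⟨1, fun p P Q => ?_⟩
  have h := color_smul g.1 g.2 P.1 Q.1
  exact rel_congr (P := P) (Q := Q) (R := g • P) (S := g • Q) h.symm

theorem exists_toPermHom_eq [Finite F] (hm : 1 < m) (hmn : m + 1 < n) (hl : 0 < l)
    {σ : Equiv.Perm (Vertex F n l m)} (hσ : σ ∈ schemeAut (rel F n l m)) :
    ∃ g, MulAction.toPermHom (PGammaLStab F n l) (Vertex F n l m) g = σ := by
  have hE : E F n l ≠ ⊥ := fun h => by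
    have := finrank_E (F := F) (n := n) (l := l)
    rw [h, finrank_bot] at this
    omega
  obtain ⟨g, hgE, hg⟩ := exists_gammaL_of_color hE hm
    (by rw [finrank_E, finrank_fin_fun]; omega) (vertexEquiv.permCongr σ)
    (fun P Q R S => color_eq_iff_of_mem_schemeAut hσ (vertexEquiv.symm P) (vertexEquiv.symm Q)
      (vertexEquiv.symm R) (vertexEquiv.symm S))
  refine ⟨⟨(QuotientGroup.mk g : GammaL F (Fin (n + l) → F) ⧸ scalars F _), hgE⟩,
    Equiv.ext fun P => Subtype.ext ?_⟩
  exact (hg (vertexEquiv P)).symm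

end Scheme

end AttenuatedSpace

/-- The action of the stabilizer of `E` in the projective semilinear group on the set of subspaces
of type `(m, 0)` identifies this stabilizer with the full automorphism group of the scheme:
the action is faithful, and its permutations are exactly the automorphisms. -/
theorem theorem1p3 {F : Type*} [Field F] [Finite F] (n l m : ℕ)
    (hm : 1 < m) (hmn : m + 1 < n) (hl : 0 < l) :
    Function.Injective (MulAction.toPermHom (AttenuatedSpace.PGammaLStab F n l)
      (AttenuatedSpace.Vertex F n l m)) ∧
    (MulAction.toPermHom (AttenuatedSpace.PGammaLStab F n l)
      (AttenuatedSpace.Vertex F n l m)).range =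
      AttenuatedSpace.schemeAut (AttenuatedSpace.rel F n l m) := by
  refine ⟨AttenuatedSpace.injective_toPermHom (by omega) hmn, le_antisymm ?_ fun σ hσ => ?_⟩
  · rintro _ ⟨g, rfl⟩
    exact AttenuatedSpace.toPermHom_mem_schemeAut g
  · exact AttenuatedSpace.exists_toPermHom_eq hm hmn hl hσ
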